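/- Let $\Lambda$ be a standard Borel space with a $\sigma$-finite Borel measure $\mu$ (for instance a bounded Borel subset of the plane with a regular Borel measure), let $n\ge 1$, and let $\varphi$ and $\varphi_{ij}$ $(1\le i,j\le n)$ be functions in $L^\infty(\mu)$. For $f\in L^\infty(\mu)$ let $M_f$ denote multiplication by $f$ on $L^2(\mu)$. Let $T$ be the bounded operator on the Hilbert space direct sum $L^2(\mu)^{(n)}$ given by the upper triangular $n\times n$ operator matrix whose diagonal entries are all $M_\varphi$, whose $(i,j)$ entry is $M_{\varphi_{ij}}$ for $i<j$, and whose entries below the diagonal are $0$. Assume that $\varphi$ is one-to-one a.e. (injective on the complement of a $\mu$-null set) and that $\varphi_{i,i+1}(\lambda)\neq 0$ for $\mu$-almost every $\lambda\in\Lambda$, for $i=1,\dots,n-1$. For a bounded operator $A$, let $\{A\}'$ be its commutant, i.e. the algebra of all bounded operators commuting with $A$. A *bounded maximal abelian set of idempotents* in $\{A\}'$ is a set of pairwise commuting idempotents in $\{A\}'$ which is not properly contained in another such set and which is bounded in operator norm. The strongly irreducible decomposition of $A$ is called *unique up to similarity* if for any two bounded maximal abelian sets of idempotents $\mathscr{P}_1,\mathscr{P}_2$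 in $\{A\}'$ there is an invertible $X\in\{A\}'$ with $X\mathscr{P}_1X^{-1}=\mathscr{P}_2$. Let $m$ be a positive integer and let $T^{(m)}=T\oplus\cdots\oplus T$ ($m$ copies), so that $\{T^{(m)}\}'=M_m(\{T\}')$. Then the strongly irreducible decomposition of $T^{(m)}$ is unique up to similarity. More concretely, let $\mathscr{P}$ be the set of orthogonal projections in $\{T\}'$ and let $\mathscr{P}\oplus\cdots\oplus\mathscr{P}$ ($m$ copies) be the set of all operators $P_1\oplus\cdots\oplus P_m$ with $P_1,\dots,P_m\in\mathscr{P}$. Then $\mathscr{P}\oplus\cdots\oplus\mathscr{P}$ is a bounded maximal abelian set of idempotents in $\{T^{(m)}\}'$, and for every bounded maximal abelian set of idempotents $\mathscr{Q}$ in $\{T^{(m)}\}'$ there is an invertible operator $X\in\{T^{(m)}\}'$ such that $$X\mathscr{Q}X^{-1}=\mathscr{P}\oplus\cdots\oplus\mathscr{P}.$$ -/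

import Mathlib

open MeasureTheory
open scoped ENNReal

noncomputable section

/-- The multiplication operator `M_f : g ↦ f g` on `L²(μ)`, for `f ∈ L^∞(μ)`. -/
def mulOp {Λ : Type*} [MeasurableSpace Λ] {μ : Measure Λ} (f : Lp ℂ ∞ μ) :
    Lp ℂ 2 μ →L[ℂ] Lp ℂ 2 μ :=
  (ContinuousLinearMap.mul ℂ ℂ).holderL μ ∞ 2 2 f

/-- The Hilbert space direct sum `H^{(k)}` of `k` copies of `H`. -/
abbrev HilbertPow (k : ℕ) (H : Type*) : Type _ := PiLp 2 (fun _ : Fin k => H)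

/-- The bounded operator on `H^{(k)}` given by a `k × k` matrix of bounded operators on `H`:
`(A x)_i = ∑ j, A_{ij} x_j`. -/
def opMatrix {k : ℕ} {H : Type*} [NormedAddCommGroup H] [InnerProductSpace ℂ H]
    (A : Matrix (Fin k) (Fin k) (H →L[ℂ] H)) : HilbertPow k H →L[ℂ] HilbertPow k H :=
  (PiLp.continuousLinearEquiv 2 ℂ (fun _ : Fin k => H)).symm.toContinuousLinearMap ∘L
    ContinuousLinearMap.pi fun i =>
      ∑ j, A i j ∘L PiLp.proj 2 (𝕜 := ℂ) (fun _ : Fin k => H) j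

/-- The direct sum operator `D_1 ⊕ ⋯ ⊕ D_k` on `H^{(k)}`. -/
def opDiag {k : ℕ} {H : Type*} [NormedAddCommGroup H] [InnerProductSpace ℂ H]
    (D : Fin k → (H →L[ℂ] H)) : HilbertPow k H →L[ℂ] HilbertPow k H :=
  opMatrix (Matrix.diagonal D)

/-- The ampliation `A^{(k)} = A ⊕ ⋯ ⊕ A` (`k` copies). -/
def ampliation {H : Type*} [NormedAddCommGroup H] [InnerProductSpace ℂ H]
    (A : H →L[ℂ] H) (k : ℕ) : HilbertPow k H →L[ℂ] HilbertPow k H :=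
  opDiag fun _ => A

/-- The upper triangular operator on `L²(μ)^{(n)}` all of whose diagonal entries are `M_φ`, and
whose `(i, j)` entry is `M_{φ_ij}` for `i < j`. (The entries `Φ i j` with `j ≤ i` are unused.) -/
def upperTriangularOp {Λ : Type*} [MeasurableSpace Λ] {μ : Measure Λ} {n : ℕ}
    (φ : Lp ℂ ∞ μ) (Φ : Fin n → Fin n → Lp ℂ ∞ μ) :
    HilbertPow n (Lp ℂ 2 μ) →L[ℂ] HilbertPow n (Lp ℂ 2 μ) :=
  opMatrix (Matrix.of fun i j =>
    if i = j then mulOp φ else if i < j then mulOp (Φ i j) else 0)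

/-- The commutant `{A}'` of a bounded operator. -/
def commutant {H : Type*} [NormedAddCommGroup H] [InnerProductSpace ℂ H]
    (A : H →L[ℂ] H) : Set (H →L[ℂ] H) :=
  {B | A * B = B * A}

/-- `S` is an abelian set of idempotents contained in `𝒜`. -/
structure IsAbelianIdempotentSet {H : Type*} [NormedAddCommGroup H] [InnerProductSpace ℂ H]
    (𝒜 S : Set (H →L[ℂ] H)) : Prop where
  subset : S ⊆ 𝒜
  idempotent : ∀ P ∈ S, IsIdempotentElem P
  commute : ∀ P ∈ S, ∀ Q ∈ S, P * Q = Q * P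

/-- `S` is a bounded maximal abelian set of idempotents in `𝒜`: it is maximal for inclusion among
the abelian sets of idempotents in `𝒜`, and it is bounded in operator norm. -/
structure IsBddMaxAbelianIdempotentSet {H : Type*} [NormedAddCommGroup H]
    [InnerProductSpace ℂ H] (𝒜 S : Set (H →L[ℂ] H)) : Prop where
  maximal : Maximal (IsAbelianIdempotentSet 𝒜) S
  bounded : ∃ C : ℝ, ∀ P ∈ S, ‖P‖ ≤ C

/-- `S` and `S'` are similar inside `𝒜`: `X S X⁻¹ = S'` for some `X ∈ 𝒜` that is invertible
in `𝒜`. -/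
def AreSimilarIn {H : Type*} [NormedAddCommGroup H] [InnerProductSpace ℂ H]
    (𝒜 S S' : Set (H →L[ℂ] H)) : Prop :=
  ∃ X : (H →L[ℂ] H)ˣ, (X : H →L[ℂ] H) ∈ 𝒜 ∧ ((X⁻¹ : (H →L[ℂ] H)ˣ) : H →L[ℂ] H) ∈ 𝒜 ∧
    (fun P => (X : H →L[ℂ] H) * P * ((X⁻¹ : (H →L[ℂ] H)ˣ) : H →L[ℂ] H)) '' S = S'

/-- The strongly irreducible decomposition of `A` is unique up to similarity: any two bounded
maximal abelian sets of idempotents in `{A}'` are similar inside `{A}'`. -/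
def HasUniqueSID {H : Type*} [NormedAddCommGroup H] [InnerProductSpace ℂ H]
    (A : H →L[ℂ] H) : Prop :=
  ∀ S S' : Set (H →L[ℂ] H), IsBddMaxAbelianIdempotentSet (commutant A) S →
    IsBddMaxAbelianIdempotentSet (commutant A) S' → AreSimilarIn (commutant A) S S'

/-- The set of (orthogonal) projections in `{A}'`. -/
def commutantProjections {H : Type*} [NormedAddCommGroup H] [InnerProductSpace ℂ H]
    [CompleteSpace H] (A : H →L[ℂ] H) : Set (H →L[ℂ] H) :=
  {P | P ∈ commutant A ∧ IsStarProjection P}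

/-- The set `S ⊕ ⋯ ⊕ S` (`k` copies) of operators `P_1 ⊕ ⋯ ⊕ P_k` with all `P_i ∈ S`. -/
def directSumSet {H : Type*} [NormedAddCommGroup H] [InnerProductSpace ℂ H]
    (S : Set (H →L[ℂ] H)) (k : ℕ) : Set (HilbertPow k H →L[ℂ] HilbertPow k H) :=
  {Q | ∃ D : Fin k → (H →L[ℂ] H), (∀ i, D i ∈ S) ∧ Q = opDiag D}

end

/-!
The operator `T` acts at almost every point `x` as `φ(x) + N(x)`, where `N(x)` is strictly upper
triangular with nonvanishing superdiagonal. The theorem rests on the description of its commutant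
and on a selection of rank one idempotents.

*The commutant.* If `B` commutes with `T = D + N`, `D = M_φ ⊕ ⋯ ⊕ M_φ`, then the inner derivations
of `D` and `N` commute, that of `N` is nilpotent, and so a power of `X ↦ D X - X D` annihilates `B`.
An operator annihilated by a power of `X ↦ M_φ X - X M_φ` preserves the spectral subspaces of `M_φ`
over discs (`indFun_mul_mul_indFun_eq_zero`). As `φ` is injective almost everywhere, these generate
all indicator functions, and the operator is a multiplication operator
(`exists_mulHom_of_innerDer_pow_eq_zero`). Hence the commutant of the ampliation of `T` consists of
`m × m` matrices over matrix-valued functions commuting with `N`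
(`exists_symbol_of_mem_commutant`). A matrix commuting with `N(x)` is upper triangular with constant
diagonal, so these matrices form a local ring: an idempotent block matrix over it is determined up
to the radical by its leading entries, and it vanishes if their trace does
(`IsJordanLike.eq_zero_of_leadRank_eq_zero`).

*Selection.* Let `𝒬` be bounded maximal abelian. By maximality and boundedness `𝒬` is closed under
products and countable gluing, so below any `E ∈ 𝒬` there is an `F ∈ 𝒬` with the support of `E` and
of minimal rank at almost every point; every member of `𝒬` then dominates or annihilates `F` at
almost every point (`exists_minimal`). Any rank one idempotent below `F` therefore commutes with
`𝒬`, hence belongs to `𝒬`. One exists, and it factors boundedly as a column times a row: a pivot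
`F_ii` whose leading entry is at least `1/m` in modulus is boundedly invertible
(`IsIdemSymbol.exists_rankOne`). Iterating yields rank one idempotents `u_k v_k ∈ 𝒬` with
`v_k u_l = δ_kl`, `k = 1, …, m` (`exists_biorthogonal`).

*Conclusion.* The matrix with rows `v_k` is invertible, with inverse the matrix with columns `u_k`,
and conjugates `u_k v_k` to the diagonal matrix units (`exists_conj_single`). A commuting family of
idempotents containing the diagonal matrix units consists of diagonal matrices, whose entries are
idempotents of the commutant of `T`, i.e. indicator functions (`subset_directSumSet`); maximality
turns this inclusion into equality.
-/

/-! ### Bounded measurable functions as multiplication operators -/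

/-- The algebra of bounded measurable functions `Λ → ℂ`. Working with genuine functions instead of
classes in `L^∞` makes evaluation at a point a ring homomorphism. -/
def BddFun (Λ : Type*) [MeasurableSpace Λ] : Subalgebra ℂ (Λ → ℂ) where
  carrier := {f | Measurable f ∧ ∃ C : ℝ, ∀ x, ‖f x‖ ≤ C}
  mul_mem' := by
    rintro f g ⟨hf, C, hC⟩ ⟨hg, D, hD⟩
    refine ⟨hf.mul hg, C * D, fun x => ?_⟩
    rw [Pi.mul_apply, norm_mul]
    exact mul_le_mul (hC x) (hD x) (norm_nonneg _) ((norm_nonneg _).trans (hC x))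
  add_mem' := by
    rintro f g ⟨hf, C, hC⟩ ⟨hg, D, hD⟩
    exact ⟨hf.add hg, C + D, fun x => (norm_add_le _ _).trans (add_le_add (hC x) (hD x))⟩
  algebraMap_mem' := fun c => ⟨measurable_const, ‖c‖, fun _ => le_rfl⟩

section MultiplicationOperators

variable {Λ : Type*} [MeasurableSpace Λ] {μ : Measure Λ}

theorem memLp_top_bddFun (f : BddFun Λ) : MemLp (f : Λ → ℂ) ∞ μ := by
  obtain ⟨f, hf, C, hC⟩ := f
  exact memLp_top_of_bound hf.aestronglyMeasurable C (Filter.Eventually.of_forall hC)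

theorem coeFn_mulOp (f : Lp ℂ ∞ μ) (g : Lp ℂ 2 μ) :
    (mulOp f g : Λ → ℂ) =ᵐ[μ] fun x => f x * g x :=
  (ContinuousLinearMap.mul ℂ ℂ).coeFn_holder f g

theorem coeFn_mulOp_toLp (f : BddFun Λ) (g : Lp ℂ 2 μ) :
    (mulOp (memLp_top_bddFun (μ := μ) f).toLp g : Λ → ℂ) =ᵐ[μ] fun x => (f : Λ → ℂ) x * g x := by
  filter_upwards [coeFn_mulOp (memLp_top_bddFun (μ := μ) f).toLp g,
    (memLp_top_bddFun (μ := μ) f).coeFn_toLp]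
    with x h1 h2
  rw [h1, h2]

/-- The representation of bounded measurable functions by multiplication operators. -/
noncomputable def mulHom (μ : Measure Λ) : BddFun Λ →+* (Lp ℂ 2 μ →L[ℂ] Lp ℂ 2 μ) where
  toFun f := mulOp (memLp_top_bddFun (μ := μ) f).toLp
  map_one' := by
    ext1 g
    apply Lp.ext
    filter_upwards [coeFn_mulOp_toLp (1 : BddFun Λ) g] with x h1
    rw [h1]
    exact one_mul _
  map_mul' a b := by
    ext1 g
    apply Lp.ext
    filter_upwards [coeFn_mulOp_toLp (a * b) g,
      coeFn_mulOp_toLp a (mulOp (memLp_top_bddFun (μ := μ) b).toLp g), coeFn_mulOp_toLp b g]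
      with x h1 h2 h3
    rw [h1, mul_apply_eq_comp, h2, h3]
    simp [mul_assoc]
  map_zero' := by
    ext1 g
    apply Lp.ext
    filter_upwards [coeFn_mulOp_toLp (0 : BddFun Λ) g, Lp.coeFn_zero ℂ 2 μ] with x h1 h2
    rw [h1, zero_apply, h2]
    simp
  map_add' a b := by
    ext1 g
    apply Lp.ext
    filter_upwards [coeFn_mulOp_toLp (a + b) g, coeFn_mulOp_toLp a g, coeFn_mulOp_toLp b g,
      Lp.coeFn_add (mulOp (memLp_top_bddFun (μ := μ) a).toLp g)
        (mulOp (memLp_top_bddFun (μ := μ) b).toLp g)]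
      with x h1 h2 h3 h4
    rw [h1, add_apply, h4, Pi.add_apply, h2, h3]
    simp [add_mul]

theorem coeFn_mulHom (f : BddFun Λ) (g : Lp ℂ 2 μ) :
    (mulHom μ f g : Λ → ℂ) =ᵐ[μ] fun x => (f : Λ → ℂ) x * g x :=
  coeFn_mulOp_toLp f g

theorem mulHom_congr {f g : BddFun Λ} (h : (f : Λ → ℂ) =ᵐ[μ] g) : mulHom μ f = mulHom μ g := by
  ext1 k
  apply Lp.ext
  filter_upwards [coeFn_mulHom f k, coeFn_mulHom g k, h] with x h1 h2 h3
  rw [h1, h2, h3]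

theorem exists_bddFun_ae_eq {f : Λ → ℂ} (hf : Measurable f) {C : ℝ} (hC : ∀ᵐ x ∂μ, ‖f x‖ ≤ C) :
    ∃ b : BddFun Λ, (∀ x, ‖(b : Λ → ℂ) x‖ ≤ |C|) ∧ (b : Λ → ℂ) =ᵐ[μ] f := by
  have hS : MeasurableSet {x | ‖f x‖ ≤ C} := measurableSet_le hf.norm measurable_const
  have hb : ∀ x, ‖{x | ‖f x‖ ≤ C}.indicator f x‖ ≤ |C| := by
    intro x
    by_cases h : ‖f x‖ ≤ C
    · rw [Set.indicator_of_mem (by exact h)]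
      exact h.trans (le_abs_self C)
    · rw [Set.indicator_of_notMem (by exact h)]
      simp
  refine ⟨⟨{x | ‖f x‖ ≤ C}.indicator f, hf.indicator hS, |C|, hb⟩, hb, ?_⟩
  filter_upwards [hC] with x hx
  exact Set.indicator_of_mem (by exact hx) _

theorem exists_mulHom_eq_mulOp (f : Lp ℂ ∞ μ) :
    ∃ b : BddFun Λ, (b : Λ → ℂ) =ᵐ[μ] f ∧ mulHom μ b = mulOp f := by
  have h1 : ∀ᵐ x ∂μ, ‖f x‖ ≤ ‖f‖ := by
    filter_upwards [ae_le_eLpNormEssSup (f := f) (μ := μ)] with x hx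
    rw [Lp.norm_def, ← toReal_enorm, eLpNorm_exponent_top]
    have := Lp.eLpNorm_ne_top f
    rw [eLpNorm_exponent_top] at this
    exact ENNReal.toReal_mono this hx
  obtain ⟨b, -, hb⟩ := exists_bddFun_ae_eq (Lp.stronglyMeasurable f).measurable h1
  refine ⟨b, hb, ?_⟩
  ext1 k
  apply Lp.ext
  filter_upwards [coeFn_mulHom b k, coeFn_mulOp f k, hb] with x h1 h2 h3
  rw [h1, h2, h3]

/-- The indicator function of a measurable set, as a bounded measurable function. -/
noncomputable def indFun (S : Set Λ) (hS : MeasurableSet S) : BddFun Λ :=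
  ⟨S.indicator 1, measurable_one.indicator hS, 1, fun x => by
    by_cases h : x ∈ S <;> simp [h]⟩

theorem indFun_of_mem {S : Set Λ} (hS : MeasurableSet S) {x : Λ} (h : x ∈ S) :
    (indFun S hS : Λ → ℂ) x = 1 := by simp [indFun, h]

theorem indFun_of_notMem {S : Set Λ} (hS : MeasurableSet S) {x : Λ} (h : x ∉ S) :
    (indFun S hS : Λ → ℂ) x = 0 := by simp [indFun, h]

theorem enorm_sq_eq_lintegral (h : Lp ℂ 2 μ) : ‖h‖ₑ ^ 2 = ∫⁻ x, ‖h x‖ₑ ^ 2 ∂μ := by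
  rw [Lp.enorm_def, eLpNorm_eq_lintegral_rpow_enorm_toReal (by norm_num) (by norm_num),
    ← ENNReal.rpow_natCast, ← ENNReal.rpow_mul]
  simp

theorem enorm_sq_indFun {S : Set Λ} (hS : MeasurableSet S) (h : Lp ℂ 2 μ) :
    ‖mulHom μ (indFun S hS) h‖ₑ ^ 2 = ∫⁻ x in S, ‖h x‖ₑ ^ 2 ∂μ := by
  rw [enorm_sq_eq_lintegral, ← lintegral_indicator hS]
  apply lintegral_congr_ae
  filter_upwards [coeFn_mulHom (indFun S hS) h] with x hx
  rw [hx]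
  by_cases hxS : x ∈ S
  · simp [hxS, indFun_of_mem hS hxS]
  · simp [hxS, indFun_of_notMem hS hxS]

/-- An operator commuting with all indicator functions is local, hence bounded pointwise. -/
theorem ae_norm_le_of_commute_indFun [SigmaFinite μ] {b : Lp ℂ 2 μ →L[ℂ] Lp ℂ 2 μ}
    (hb : ∀ S hS, Commute b (mulHom μ (indFun S hS))) (g : Lp ℂ 2 μ) :
    ∀ᵐ x ∂μ, ‖b g x‖ ≤ ‖b‖ * ‖g x‖ := by
  have key : (fun x => ‖b g x‖ₑ ^ 2) ≤ᵐ[μ] fun x => ‖b‖ₑ ^ 2 * ‖g x‖ₑ ^ 2 := by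
    apply ae_le_of_forall_setLIntegral_le_of_sigmaFinite
    · exact (Lp.stronglyMeasurable (b g)).measurable.enorm.pow_const 2
    · intro S hS _
      rw [lintegral_const_mul _ ((Lp.stronglyMeasurable g).measurable.enorm.pow_const 2),
        ← enorm_sq_indFun hS, ← enorm_sq_indFun hS, ← mul_pow]
      have : mulHom μ (indFun S hS) (b g) = b (mulHom μ (indFun S hS) g) :=
        (DFunLike.congr_fun (hb S hS).eq g).symm
      rw [this]
      gcongr
      exact b.le_opENorm _
  filter_upwards [key] with x hx
  rw [← mul_pow] at hx
  have h2 : ‖b g x‖ₑ ≤ ‖b‖ₑ * ‖g x‖ₑ := (ENNReal.pow_le_pow_left_iff two_ne_zero).1 hx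
  rw [← enorm_norm b, ← enorm_norm (g x), ← enorm_norm (b g x), ← enorm_mul] at h2
  have h3 := (enorm_le_iff_norm_le).1 h2
  simpa using h3

theorem exists_Lp_two_ne_zero (μ : Measure Λ) [SigmaFinite μ] :
    ∃ g : Lp ℂ 2 μ, ∀ᵐ x ∂μ, g x ≠ 0 := by
  obtain ⟨w, w_pos, hw, hint⟩ := exists_pos_lintegral_lt_of_sigmaFinite μ one_ne_zero
  have hm : Measurable fun x => ((Real.sqrt (w x) : ℝ) : ℂ) := by fun_prop
  have hL : MemLp (fun x => ((Real.sqrt (w x) : ℝ) : ℂ)) 2 μ := by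
    refine ⟨hm.aestronglyMeasurable, ?_⟩
    rw [eLpNorm_lt_top_iff_lintegral_rpow_enorm_lt_top (by norm_num) (by norm_num)]
    refine lt_of_eq_of_lt (lintegral_congr fun x => ?_) (hint.trans ENNReal.one_lt_top)
    rw [← ofReal_norm]
    simp only [Complex.norm_real, Real.norm_eq_abs, abs_of_nonneg (Real.sqrt_nonneg _)]
    simp only [ENNReal.toReal_ofNat, ENNReal.rpow_ofNat]
    rw [← ENNReal.ofReal_pow (Real.sqrt_nonneg _), Real.sq_sqrt (by positivity)]
    simp
  refine ⟨hL.toLp, ?_⟩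
  filter_upwards [hL.coeFn_toLp] with x hx
  rw [hx]
  have := Real.sqrt_pos.2 (show (0:ℝ) < w x from w_pos x)
  exact_mod_cast this.ne'

theorem commute_mulHom (a b : BddFun Λ) : Commute (mulHom μ a) (mulHom μ b) :=
  (Commute.all a b).map (mulHom μ)

theorem ae_norm_le_norm_mulHom [SigmaFinite μ] (f : BddFun Λ) :
    ∀ᵐ x ∂μ, ‖(f : Λ → ℂ) x‖ ≤ ‖mulHom μ f‖ := by
  obtain ⟨g, hg⟩ := exists_Lp_two_ne_zero μ
  filter_upwards [ae_norm_le_of_commute_indFun (fun S hS => commute_mulHom (μ := μ) f _) g, hg,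
    coeFn_mulHom f g] with x h1 h2 h3
  rw [h3, norm_mul] at h1
  exact le_of_mul_le_mul_right h1 (norm_pos_iff.2 h2)

theorem mulHom_eq_iff [SigmaFinite μ] {f g : BddFun Λ} :
    mulHom μ f = mulHom μ g ↔ (f : Λ → ℂ) =ᵐ[μ] g := by
  refine ⟨fun h => ?_, mulHom_congr⟩
  filter_upwards [ae_norm_le_norm_mulHom (μ := μ) (f - g)] with x hx
  rw [map_sub, h, sub_self, norm_zero] at hx
  simpa [sub_eq_zero] using hx

/-- The multiplication operators form a maximal abelian algebra: an operator commuting with all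
indicator functions is the multiplication by a bounded function. -/
theorem exists_mulHom_of_commute_indFun [SigmaFinite μ] {b : Lp ℂ 2 μ →L[ℂ] Lp ℂ 2 μ}
    (hb : ∀ S hS, Commute b (mulHom μ (indFun S hS))) : ∃ f, mulHom μ f = b := by
  obtain ⟨g, hg⟩ := exists_Lp_two_ne_zero μ
  have hbd : ∀ᵐ x ∂μ, ‖b g x / g x‖ ≤ ‖b‖ := by
    filter_upwards [ae_norm_le_of_commute_indFun hb g, hg] with x h1 h2
    rw [norm_div]
    exact (div_le_iff₀ (norm_pos_iff.2 h2)).2 h1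
  obtain ⟨f, -, hf⟩ := exists_bddFun_ae_eq
    ((Lp.stronglyMeasurable (b g)).measurable.div (Lp.stronglyMeasurable g).measurable) hbd
  refine ⟨f, ?_⟩
  -- `d` annihilates the nowhere vanishing `g`, hence every `1_S g`; these span a dense subspace
  set d := b - mulHom μ f with hd
  have hdg : d g = 0 := by
    apply Lp.ext
    filter_upwards [Lp.coeFn_sub (b g) (mulHom μ f g), coeFn_mulHom f g, hf, hg,
      Lp.coeFn_zero ℂ 2 μ] with x h1 h2 h3 h4 h5
    rw [hd, sub_apply, h1, Pi.sub_apply, h2, h3, h5, Pi.div_apply, div_mul_cancel₀ _ h4]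
    simp
  have hdS : ∀ S hS, d (mulHom μ (indFun S hS) g) = 0 := by
    intro S hS
    have h : Commute d (mulHom μ (indFun S hS)) := (hb S hS).sub_left (commute_mulHom _ _)
    have h2 := DFunLike.congr_fun h.eq g
    simp only [mul_apply_eq_comp, hdg, map_zero] at h2
    exact h2
  have hker : (LinearMap.ker d.toLinearMap)ᗮ = ⊥ := by
    rw [Submodule.eq_bot_iff]
    intro k hk
    have h1 : ∀ S hS, inner ℂ (mulHom μ (indFun S hS) g) k = 0 := fun S hS =>
      (Submodule.mem_orthogonal _ _).1 hk _ (hdS S hS)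
    have hint : Integrable (fun x => inner ℂ (g x) (k x)) μ := L2.integrable_inner g k
    have h2 : (fun x => inner ℂ (g x) (k x)) =ᵐ[μ] 0 := by
      apply hint.ae_eq_zero_of_forall_setIntegral_eq_zero
      intro S hS _
      rw [← integral_indicator hS, ← h1 S hS, L2.inner_def]
      apply integral_congr_ae
      filter_upwards [coeFn_mulHom (indFun S hS) g] with x hx
      rw [hx]
      by_cases hxS : x ∈ S
      · simp [hxS, indFun_of_mem hS hxS]
      · simp [hxS, indFun_of_notMem hS hxS]
    apply Lp.ext
    filter_upwards [h2, hg, Lp.coeFn_zero ℂ 2 μ] with x h3 h4 h5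
    rw [h5]
    simpa [h4] using h3
  have htop : LinearMap.ker d.toLinearMap = ⊤ := by
    have hc : IsClosed (LinearMap.ker d.toLinearMap : Set (Lp ℂ 2 μ)) :=
      ContinuousLinearMap.isClosed_ker d
    have := hc.completeSpace_coe
    exact (Submodule.orthogonal_eq_bot_iff).1 hker
  have hd0 : d = 0 := by
    ext1 k
    have : k ∈ LinearMap.ker d.toLinearMap := htop ▸ Submodule.mem_top
    exact this
  exact (sub_eq_zero.1 hd0).symm

end MultiplicationOperators

/-! ### Operators annihilated by a power of a derivation -/

section NormedRing

variable {R : Type*} [NormedRing R]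

theorem eq_zero_of_eq_mul_mul {A B X : R} (h : X = A * X * B) (hAB : ‖A‖ * ‖B‖ < 1) : X = 0 := by
  have h1 : ‖X‖ ≤ (‖A‖ * ‖B‖) * ‖X‖ := by
    calc ‖X‖ = ‖A * X * B‖ := by rw [← h]
      _ ≤ ‖A‖ * ‖X‖ * ‖B‖ := (norm_mul_le _ _).trans (by gcongr; exact norm_mul_le _ _)
      _ = _ := by ring
  by_contra hX
  have := norm_pos_iff.2 hX
  nlinarith

end NormedRing

section Derivation

variable {A : Type*} [Ring A] [Algebra ℂ A]

/-- The inner derivation `X ↦ M X - X M`. -/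
def innerDer (M : A) : Module.End ℂ A := LinearMap.mulLeft ℂ M - LinearMap.mulRight ℂ M

theorem innerDer_apply (M X : A) : innerDer M X = M * X - X * M := rfl

theorem innerDer_pow_sandwich {M p q : A} (hp : Commute M p) (hq : Commute M q) (k : ℕ) (X : A) :
    (innerDer M ^ k) (p * X * q) = p * (innerDer M ^ k) X * q := by
  induction k generalizing X with
  | zero => simp
  | succ k ih =>
    rw [pow_succ, Module.End.mul_apply, Module.End.mul_apply, ← ih, innerDer_apply, innerDer_apply]
    congr 1
    rw [mul_sub, sub_mul]
    congr 1
    · rw [← mul_assoc, ← mul_assoc, hp.eq, mul_assoc p M X]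
    · rw [mul_assoc, ← hq.eq]
      simp only [mul_assoc]

/-- If no nonzero element of the corner `p A q` commutes with `M`, then none is annihilated by a
power of the derivation `innerDer M`. -/
theorem eq_zero_of_innerDer_pow_eq_zero {M p q : A} (hp : Commute M p) (hq : Commute M q)
    (h : ∀ X, p * X = X → X * q = X → Commute M X → X = 0) (k : ℕ) :
    ∀ X, p * X = X → X * q = X → (innerDer M ^ k) X = 0 → X = 0 := by
  induction k with
  | zero => intro X _ _ h0; simpa using h0
  | succ k ih =>
    intro X hpX hXq h0
    apply h X hpX hXq
    rw [pow_succ, Module.End.mul_apply, innerDer_apply] at h0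
    apply sub_eq_zero.1 (ih _ ?_ ?_ h0)
    · rw [mul_sub, ← mul_assoc, ← mul_assoc, hpX, ← hp.eq, mul_assoc, hpX]
    · rw [sub_mul, mul_assoc, mul_assoc, hXq, hq.eq, ← mul_assoc, hXq]

end Derivation

section Commutant

variable {Λ : Type*} [MeasurableSpace Λ] {μ : Measure Λ}

theorem norm_mulHom_le {f : BddFun Λ} {C : ℝ} (hC : 0 ≤ C) (h : ∀ x, ‖(f : Λ → ℂ) x‖ ≤ C) :
    ‖mulHom μ f‖ ≤ C := by
  refine ContinuousLinearMap.opNorm_le_bound _ hC fun g => ?_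
  apply Lp.norm_le_mul_norm_of_ae_le_mul
  filter_upwards [coeFn_mulHom f g] with x hx
  rw [hx, norm_mul]
  gcongr
  exact h x

theorem indFun_mul (S T : Set Λ) (hS : MeasurableSet S) (hT : MeasurableSet T) :
    indFun S hS * indFun T hT = indFun (S ∩ T) (hS.inter hT) := by
  apply Subtype.ext
  funext x
  by_cases h1 : x ∈ S <;> by_cases h2 : x ∈ T <;> simp [indFun, h1, h2]

theorem indFun_mul_self (S : Set Λ) (hS : MeasurableSet S) :
    indFun S hS * indFun S hS = indFun S hS := by
  apply Subtype.ext
  funext x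
  by_cases h1 : x ∈ S <;> simp [indFun, h1]

theorem indFun_compl (S : Set Λ) (hS : MeasurableSet S) :
    indFun Sᶜ hS.compl = 1 - indFun S hS := by
  apply Subtype.ext
  funext x
  by_cases h1 : x ∈ S <;> simp [indFun, h1]

theorem isSelfAdjoint_mulHom_indFun (S : Set Λ) (hS : MeasurableSet S) :
    IsSelfAdjoint (mulHom μ (indFun S hS)) := by
  rw [ContinuousLinearMap.isSelfAdjoint_iff_isSymmetric]
  intro f g
  change inner ℂ (mulHom μ (indFun S hS) f) g = inner ℂ f (mulHom μ (indFun S hS) g)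
  rw [L2.inner_def, L2.inner_def]
  apply integral_congr_ae
  filter_upwards [coeFn_mulHom (indFun S hS) f, coeFn_mulHom (indFun S hS) g] with x h1 h2
  rw [h1, h2]
  by_cases hxS : x ∈ S
  · simp [indFun_of_mem hS hxS]
  · simp [indFun_of_notMem hS hxS]

theorem indFun_iUnion_mul_eq_zero {S : ℕ → Set Λ} (hS : ∀ n, MeasurableSet (S n))
    {Y : Lp ℂ 2 μ →L[ℂ] Lp ℂ 2 μ} (h : ∀ n, mulHom μ (indFun (S n) (hS n)) * Y = 0) :
    mulHom μ (indFun (⋃ n, S n) (MeasurableSet.iUnion hS)) * Y = 0 := by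
  ext1 f
  apply Lp.ext
  have h1 : ∀ n, ∀ᵐ x ∂μ, (indFun (S n) (hS n) : Λ → ℂ) x * Y f x = 0 := by
    intro n
    have h2 : mulHom μ (indFun (S n) (hS n)) (Y f) = 0 := DFunLike.congr_fun (h n) f
    filter_upwards [coeFn_mulHom (indFun (S n) (hS n)) (Y f), Lp.coeFn_zero ℂ 2 μ] with x h3 h4
    rw [← h3, h2, h4, Pi.zero_apply]
  filter_upwards [ae_all_iff.2 h1, coeFn_mulHom (indFun _ (MeasurableSet.iUnion hS)) (Y f),
    Lp.coeFn_zero ℂ 2 μ] with x h3 h4 h5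
  rw [mul_apply_eq_comp, h4, zero_apply, h5, Pi.zero_apply]
  by_cases hx : x ∈ ⋃ n, S n
  · obtain ⟨n, hn⟩ := Set.mem_iUnion.1 hx
    have := h3 n
    rw [indFun_of_mem _ hn] at this
    rwa [indFun_of_mem _ hx]
  · rw [indFun_of_notMem _ hx, zero_mul]

theorem mul_indFun_iUnion_eq_zero {S : ℕ → Set Λ} (hS : ∀ n, MeasurableSet (S n))
    {Y : Lp ℂ 2 μ →L[ℂ] Lp ℂ 2 μ} (h : ∀ n, Y * mulHom μ (indFun (S n) (hS n)) = 0) :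
    Y * mulHom μ (indFun (⋃ n, S n) (MeasurableSet.iUnion hS)) = 0 := by
  apply star_injective
  rw [star_mul, star_zero, (isSelfAdjoint_mulHom_indFun _ _).star_eq]
  apply indFun_iUnion_mul_eq_zero
  intro n
  have := congrArg star (h n)
  rwa [star_mul, star_zero, (isSelfAdjoint_mulHom_indFun _ _).star_eq] at this

theorem commute_indFun_iff {S : Set Λ} (hS : MeasurableSet S) {b : Lp ℂ 2 μ →L[ℂ] Lp ℂ 2 μ} :
    Commute b (mulHom μ (indFun S hS)) ↔
      mulHom μ (indFun Sᶜ hS.compl) * b * mulHom μ (indFun S hS) = 0 ∧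
      mulHom μ (indFun S hS) * b * mulHom μ (indFun Sᶜ hS.compl) = 0 := by
  have hp : mulHom μ (indFun S hS) * mulHom μ (indFun S hS) = mulHom μ (indFun S hS) := by
    rw [← map_mul, indFun_mul_self]
  rw [indFun_compl S hS, map_sub, map_one]
  set p := mulHom μ (indFun S hS)
  constructor
  · intro h
    constructor
    · rw [mul_assoc, h.eq, ← mul_assoc, sub_mul, one_mul, hp, sub_self, zero_mul]
    · rw [← h.eq, mul_assoc, mul_sub, mul_one, hp, sub_self, mul_zero]
  · rintro ⟨h1, h2⟩
    rw [sub_mul, one_mul, sub_mul, sub_eq_zero] at h1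
    rw [mul_sub, mul_one, sub_eq_zero] at h2
    exact h1.trans h2.symm

/-- The measurable sets whose indicator functions commute with `b`. -/
@[reducible] def commutingSets (b : Lp ℂ 2 μ →L[ℂ] Lp ℂ 2 μ) : MeasurableSpace Λ where
  MeasurableSet' S := ∃ hS : MeasurableSet S, Commute b (mulHom μ (indFun S hS))
  measurableSet_empty := by
    refine ⟨MeasurableSet.empty, ?_⟩
    have : indFun (∅ : Set Λ) MeasurableSet.empty = 0 := by
      apply Subtype.ext; funext x; simp [indFun]
    rw [this, map_zero]
    exact Commute.zero_right _
  measurableSet_compl := by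
    rintro S ⟨hS, h⟩
    refine ⟨hS.compl, ?_⟩
    rw [indFun_compl S hS, map_sub, map_one]
    exact (Commute.one_right b).sub_right h
  measurableSet_iUnion := by
    intro S h
    choose hS h using h
    refine ⟨MeasurableSet.iUnion hS, (commute_indFun_iff _).2 ⟨?_, ?_⟩⟩
    · apply mul_indFun_iUnion_eq_zero
      intro n
      rw [mul_assoc, (h n).eq, ← mul_assoc, ← map_mul, indFun_mul]
      have : indFun ((⋃ n, S n)ᶜ ∩ S n) ((MeasurableSet.iUnion hS).compl.inter (hS n)) = 0 := by
        apply Subtype.ext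
        funext x
        apply indFun_of_notMem
        exact fun hx => hx.1 (Set.mem_iUnion.2 ⟨n, hx.2⟩)
      rw [this, map_zero, zero_mul]
    · rw [mul_assoc]
      apply indFun_iUnion_mul_eq_zero
      intro n
      rw [← mul_assoc, ← (h n).eq, mul_assoc, ← map_mul, indFun_mul]
      have : indFun (S n ∩ (⋃ n, S n)ᶜ) ((hS n).inter (MeasurableSet.iUnion hS).compl) = 0 := by
        apply Subtype.ext
        funext x
        apply indFun_of_notMem
        exact fun hx => hx.2 (Set.mem_iUnion.2 ⟨n, hx.1⟩)
      rw [this, map_zero, mul_zero]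

theorem innerDer_mulHom_sub_const (φ : BddFun Λ) (a : ℂ) :
    innerDer (mulHom μ (φ - algebraMap ℂ _ a)) =
      innerDer (mulHom μ φ) := by
  have h : mulHom μ (algebraMap ℂ _ a) = algebraMap ℂ (Lp ℂ 2 μ →L[ℂ] Lp ℂ 2 μ) a := by
    ext1 f
    apply Lp.ext
    filter_upwards [coeFn_mulHom (algebraMap ℂ (BddFun Λ) a) f, Lp.coeFn_smul a f] with x h1 h2
    rw [h1]
    change _ = (a • f : Lp ℂ 2 μ) x
    rw [h2]
    rfl
  ext1 X
  rw [innerDer_apply, innerDer_apply, map_sub, h, sub_mul, mul_sub, ← Algebra.commutes a X]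
  abel

/-- If a power of the derivation `X ↦ M_φ X - X M_φ` annihilates `b`, then `b` does not connect the
spectral subspaces of `M_φ` over a disc and over the complement of a larger concentric disc. -/
theorem indFun_mul_mul_indFun_eq_zero {φ : BddFun Λ} {b : Lp ℂ 2 μ →L[ℂ] Lp ℂ 2 μ} {k : ℕ}
    (hb : (innerDer (mulHom μ φ) ^ k) b = 0) (a : ℂ) {ε δ : ℝ} (hε : 0 ≤ ε) (hεδ : ε < δ)
    {S T : Set Λ} (hS : MeasurableSet S) (hT : MeasurableSet T)
    (hSφ : ∀ x ∈ S, ‖(φ : Λ → ℂ) x - a‖ ≤ ε) (hTφ : ∀ x ∈ T, δ ≤ ‖(φ : Λ → ℂ) x - a‖) :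
    mulHom μ (indFun T hT) * b * mulHom μ (indFun S hS) = 0 ∧
      mulHom μ (indFun S hS) * b * mulHom μ (indFun T hT) = 0 := by
  have hδ : 0 < δ := hε.trans_lt hεδ
  set ψ : BddFun Λ := φ - algebraMap ℂ _ a with hψ
  have hψx : ∀ x, (ψ : Λ → ℂ) x = (φ : Λ → ℂ) x - a := fun x => rfl
  rw [← innerDer_mulHom_sub_const φ a, ← hψ] at hb
  have hmeas : Measurable (φ : Λ → ℂ) := φ.2.1
  -- `w` inverts `ψ` on `T`
  have hwb : ∀ x, ‖T.indicator (fun x => ((φ : Λ → ℂ) x - a)⁻¹) x‖ ≤ δ⁻¹ := by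
    intro x
    by_cases hx : x ∈ T
    · rw [Set.indicator_of_mem hx, norm_inv]
      exact inv_anti₀ hδ (hTφ x hx)
    · rw [Set.indicator_of_notMem hx, norm_zero]
      positivity
  let w : BddFun Λ := ⟨T.indicator (fun x => ((φ : Λ → ℂ) x - a)⁻¹),
    (hmeas.sub_const a).inv.indicator hT, δ⁻¹, hwb⟩
  have hw : w * ψ = indFun T hT := by
    apply Subtype.ext
    funext x
    change T.indicator (fun x => ((φ : Λ → ℂ) x - a)⁻¹) x * ((φ : Λ → ℂ) x - a) = _
    by_cases hx : x ∈ T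
    · rw [Set.indicator_of_mem hx, indFun_of_mem hT hx, inv_mul_cancel₀]
      exact norm_pos_iff.1 (hδ.trans_le (hTφ x hx))
    · rw [Set.indicator_of_notMem hx, indFun_of_notMem hT hx, zero_mul]
  have hwn : ‖mulHom μ w‖ ≤ δ⁻¹ := norm_mulHom_le (by positivity) hwb
  have hpn : ‖mulHom μ (indFun S hS * ψ)‖ ≤ ε := by
    refine norm_mulHom_le hε fun x => ?_
    change ‖(indFun S hS : Λ → ℂ) x * (ψ : Λ → ℂ) x‖ ≤ ε
    by_cases hx : x ∈ S
    · rw [indFun_of_mem hS hx, one_mul]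
      exact hSφ x hx
    · rwa [indFun_of_notMem hS hx, zero_mul, norm_zero]
  have hlt : ‖mulHom μ w‖ * ‖mulHom μ (indFun S hS * ψ)‖ < 1 := by
    calc _ ≤ δ⁻¹ * ε := by gcongr
      _ < 1 := by rw [inv_mul_lt_iff₀ hδ]; simpa using hεδ
  have hcS : Commute (mulHom μ ψ) (mulHom μ (indFun S hS)) := commute_mulHom _ _
  have hcT : Commute (mulHom μ ψ) (mulHom μ (indFun T hT)) := commute_mulHom _ _
  have hSS : mulHom μ (indFun S hS) * mulHom μ (indFun S hS) = mulHom μ (indFun S hS) := by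
    rw [← map_mul, indFun_mul_self]
  have hTT : mulHom μ (indFun T hT) * mulHom μ (indFun T hT) = mulHom μ (indFun T hT) := by
    rw [← map_mul, indFun_mul_self]
  constructor
  · refine eq_zero_of_innerDer_pow_eq_zero hcT hcS ?_ k _ ?_ ?_ ?_
    · intro X hTX hXS hX
      refine eq_zero_of_eq_mul_mul (A := mulHom μ w) (B := mulHom μ (indFun S hS * ψ)) ?_ hlt
      calc X = mulHom μ (w * ψ) * X := by rw [hw, hTX]
        _ = mulHom μ w * (mulHom μ ψ * X) := by rw [map_mul, mul_assoc]
        _ = mulHom μ w * ((X * mulHom μ (indFun S hS)) * mulHom μ ψ) := by rw [hX.eq, hXS]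
        _ = _ := by rw [map_mul]; simp only [mul_assoc]
    · rw [← mul_assoc, ← mul_assoc, hTT]
    · rw [mul_assoc, hSS]
    · rw [innerDer_pow_sandwich hcT hcS, hb, mul_zero, zero_mul]
  · refine eq_zero_of_innerDer_pow_eq_zero hcS hcT ?_ k _ ?_ ?_ ?_
    · intro X hSX hXT hX
      rw [mul_comm] at hlt
      refine eq_zero_of_eq_mul_mul (A := mulHom μ (indFun S hS * ψ)) (B := mulHom μ w) ?_ hlt
      calc X = X * mulHom μ (ψ * w) := by rw [mul_comm, hw, hXT]
        _ = (X * mulHom μ ψ) * mulHom μ w := by rw [map_mul, mul_assoc]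
        _ = (mulHom μ ψ * (mulHom μ (indFun S hS) * X)) * mulHom μ w := by rw [← hX.eq, hSX]
        _ = _ := by rw [mul_comm (indFun S hS), map_mul]; simp only [mul_assoc]
    · rw [← mul_assoc, ← mul_assoc, hSS]
    · rw [mul_assoc, hTT]
    · rw [innerDer_pow_sandwich hcS hcT, hb, mul_zero, zero_mul]

theorem measurableSet_commutingSets_closedBall {φ : BddFun Λ} {b : Lp ℂ 2 μ →L[ℂ] Lp ℂ 2 μ}
    {k : ℕ} (hb : (innerDer (mulHom μ φ) ^ k) b = 0) (a : ℂ) {ε : ℝ} (hε : 0 ≤ ε) :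
    MeasurableSet[commutingSets b] ((φ : Λ → ℂ) ⁻¹' Metric.closedBall a ε) := by
  have hmeas : Measurable (φ : Λ → ℂ) := φ.2.1
  have hS : MeasurableSet ((φ : Λ → ℂ) ⁻¹' Metric.closedBall a ε) :=
    hmeas Metric.isClosed_closedBall.measurableSet
  have hT : ∀ n : ℕ, MeasurableSet {x | ε + ((n : ℝ) + 1)⁻¹ ≤ ‖(φ : Λ → ℂ) x - a‖} := fun n =>
    measurableSet_le measurable_const (hmeas.sub_const a).norm
  have hU : ((φ : Λ → ℂ) ⁻¹' Metric.closedBall a ε)ᶜ =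
      ⋃ n : ℕ, {x | ε + ((n : ℝ) + 1)⁻¹ ≤ ‖(φ : Λ → ℂ) x - a‖} := by
    ext x
    simp only [Set.mem_compl_iff, Set.mem_preimage, mem_closedBall_iff_norm, not_le,
      Set.mem_iUnion, Set.mem_ofPred_eq]
    constructor
    · intro h
      obtain ⟨n, hn⟩ := exists_nat_one_div_lt (sub_pos.2 h)
      refine ⟨n, ?_⟩
      rw [one_div] at hn
      linarith
    · rintro ⟨n, hn⟩
      have : (0 : ℝ) < ((n : ℝ) + 1)⁻¹ := by positivity
      linarith
  have key := fun n : ℕ => indFun_mul_mul_indFun_eq_zero hb a hε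
    (show ε < ε + ((n : ℝ) + 1)⁻¹ from lt_add_of_pos_right _ (by positivity)) hS (hT n)
    (fun x hx => mem_closedBall_iff_norm.1 hx) (fun x hx => hx)
  refine ⟨hS, (commute_indFun_iff hS).2 ⟨?_, ?_⟩⟩
  · have := indFun_iUnion_mul_eq_zero hT (Y := b * mulHom μ (indFun _ hS))
      (fun n => by rw [← mul_assoc]; exact (key n).1)
    rw [mul_assoc]
    convert this
  · have := mul_indFun_iUnion_eq_zero hT (Y := mulHom μ (indFun _ hS) * b) (fun n => (key n).2)
    convert this

/-- If `φ` is injective almost everywhere, every operator annihilated by a power of the derivation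
`X ↦ M_φ X - X M_φ` is a multiplication operator. -/
theorem exists_mulHom_of_innerDer_pow_eq_zero [StandardBorelSpace Λ] [SigmaFinite μ] {φ : BddFun Λ}
    {s : Set Λ} (hs : μ sᶜ = 0) (hφ : Set.InjOn (φ : Λ → ℂ) s)
    {b : Lp ℂ 2 μ →L[ℂ] Lp ℂ 2 μ} {k : ℕ}
    (hb : (innerDer (mulHom μ φ) ^ k) b = 0) : ∃ f, mulHom μ f = b := by
  have hmeas : Measurable (φ : Λ → ℂ) := φ.2.1
  have hborel : Measurable[commutingSets b] (φ : Λ → ℂ) := by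
    apply @measurable_of_isOpen _ _ _ _ _ (commutingSets b)
    intro U hU
    have hr : ∀ z : ℂ, ∃ r : ℝ, 0 < r ∧ (z ∈ U → Metric.closedBall z r ⊆ U) := by
      intro z
      by_cases hz : z ∈ U
      · obtain ⟨r, hr, h⟩ := Metric.nhds_basis_closedBall.mem_iff.1 (hU.mem_nhds hz)
        exact ⟨r, hr, fun _ => h⟩
      · exact ⟨1, one_pos, fun h => absurd h hz⟩
    choose r hr0 hr using hr
    obtain ⟨t, htU, htc, hcov⟩ := TopologicalSpace.countable_cover_nhdsWithin
      (f := fun z => Metric.closedBall z (r z)) (s := U)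
      (fun z _ => mem_nhdsWithin_of_mem_nhds (Metric.closedBall_mem_nhds z (hr0 z)))
    have hUeq : U = ⋃ z ∈ t, Metric.closedBall z (r z) :=
      hcov.antisymm (Set.iUnion₂_subset fun z hz => hr z (htU hz))
    rw [hUeq, Set.preimage_iUnion₂]
    exact @MeasurableSet.biUnion _ _ (commutingSets b) _ _ htc
      fun z _ => measurableSet_commutingSets_closedBall hb z (hr0 z).le
  obtain ⟨t, hst, ht, ht0⟩ := exists_measurable_superset_of_null hs
  have htinj : Set.InjOn (φ : Λ → ℂ) tᶜ := hφ.mono (Set.compl_subset_comm.1 hst)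
  apply exists_mulHom_of_commute_indFun
  intro S hS
  have hA : MeasurableSet ((φ : Λ → ℂ) '' (S ∩ tᶜ)) :=
    (hS.inter ht.compl).image_of_measurable_injOn hmeas (htinj.mono Set.inter_subset_right)
  obtain ⟨hm, hc⟩ := hborel hA
  have : mulHom μ (indFun S hS) = mulHom μ (indFun _ hm) := by
    apply mulHom_congr
    filter_upwards [measure_eq_zero_iff_ae_notMem.1 ht0] with x hx
    by_cases hxS : x ∈ S
    · rw [indFun_of_mem hS hxS, indFun_of_mem hm (Set.mem_image_of_mem _ ⟨hxS, hx⟩)]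
    · rw [indFun_of_notMem hS hxS, indFun_of_notMem hm]
      rintro ⟨y, ⟨hyS, hyt⟩, hy⟩
      exact hxS (htinj hyt hx hy ▸ hyS)
  rw [this]
  exact hc

end Commutant

/-! ### Operator matrices and symbols -/

section OperatorMatrices

variable {k : ℕ} {H : Type*} [NormedAddCommGroup H] [InnerProductSpace ℂ H]

theorem opMatrix_apply (A : Matrix (Fin k) (Fin k) (H →L[ℂ] H)) (x : HilbertPow k H) (i : Fin k) :
    opMatrix A x i = ∑ j, A i j (x j) := by
  simp [opMatrix]

/-- The inclusion of the `j`-th summand in `H^{(k)}`. -/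
noncomputable def summandIncl (j : Fin k) : H →L[ℂ] HilbertPow k H :=
  (PiLp.continuousLinearEquiv 2 ℂ (fun _ : Fin k => H)).symm.toContinuousLinearMap ∘L
    ContinuousLinearMap.single ℂ (fun _ : Fin k => H) j

theorem summandIncl_apply (j : Fin k) (x : H) (i : Fin k) :
    summandIncl j x i = if i = j then x else 0 := by
  simp [summandIncl]

theorem sum_summandIncl (x : HilbertPow k H) : ∑ j, summandIncl j (x j) = x := by
  ext i
  simp [summandIncl_apply]

/-- Operators on `H^{(k)}` are the same as `k × k` matrices of operators on `H`. -/
noncomputable def opMatrixEquiv (k : ℕ) (H : Type*) [NormedAddCommGroup H]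
    [InnerProductSpace ℂ H] :
    Matrix (Fin k) (Fin k) (H →L[ℂ] H) ≃+* (HilbertPow k H →L[ℂ] HilbertPow k H) where
  toFun := opMatrix
  invFun A := Matrix.of fun i j =>
    PiLp.proj 2 (𝕜 := ℂ) (fun _ : Fin k => H) i ∘L A ∘L summandIncl j
  left_inv A := by
    ext i j x
    simp [opMatrix_apply, summandIncl_apply, apply_ite]
  right_inv A := by
    ext x i
    rw [opMatrix_apply]
    conv_rhs => rw [← sum_summandIncl x, map_sum]
    simp
  map_mul' A B := by
    ext x i
    rw [mul_apply_eq_comp, opMatrix_apply, opMatrix_apply]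
    simp only [opMatrix_apply, Matrix.mul_apply, map_sum, sum_apply,
      mul_apply_eq_comp]
    exact Finset.sum_comm
  map_add' A B := by
    ext x i
    simp [opMatrix_apply, Finset.sum_add_distrib]

theorem opMatrixEquiv_apply (A : Matrix (Fin k) (Fin k) (H →L[ℂ] H)) :
    opMatrixEquiv k H A = opMatrix A := rfl

theorem opDiag_apply (D : Fin k → (H →L[ℂ] H)) (x : HilbertPow k H) (i : Fin k) :
    opDiag D x i = D i (x i) := by
  rw [opDiag, opMatrix_apply, Finset.sum_eq_single i]
  · simp
  · intro j _ hj
    simp [Matrix.diagonal_apply_ne' _ hj]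
  · simp

theorem norm_opDiag_le {D : Fin k → (H →L[ℂ] H)} (hD : ∀ i, ‖D i‖ ≤ 1) :
    ‖opDiag D‖ ≤ 1 := by
  refine ContinuousLinearMap.opNorm_le_bound _ zero_le_one fun x => ?_
  rw [one_mul, PiLp.norm_eq_of_L2, PiLp.norm_eq_of_L2]
  apply Real.sqrt_le_sqrt
  refine Finset.sum_le_sum fun i _ => ?_
  rw [opDiag_apply]
  have h2 : ‖D i (x i)‖ ≤ ‖x i‖ := by
    simpa using (D i).le_of_opNorm_le (hD i) (x i)
  gcongr

theorem norm_opMatrix_entry_le (A : Matrix (Fin k) (Fin k) (H →L[ℂ] H)) (i j : Fin k) :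
    ‖A i j‖ ≤ ‖opMatrix A‖ := by
  refine ContinuousLinearMap.opNorm_le_bound _ (opMatrix A).opNorm_nonneg fun x => ?_
  have h1 : opMatrix A (summandIncl j x) i = A i j x := by
    simp [opMatrix_apply, summandIncl_apply, apply_ite]
  have h2 : ‖summandIncl (k := k) j x‖ = ‖x‖ := by
    rw [PiLp.norm_eq_of_L2, Finset.sum_eq_single j]
    · simp [summandIncl_apply]
    · intro i _ hi
      simp [summandIncl_apply, hi]
    · simp
  rw [← h1, ← h2]
  exact (PiLp.norm_apply_le _ i).trans ((opMatrix A).le_opNorm _)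

theorem isSelfAdjoint_opDiag [CompleteSpace H] {D : Fin k → (H →L[ℂ] H)}
    (hD : ∀ i, IsSelfAdjoint (D i)) : IsSelfAdjoint (opDiag D) := by
  rw [ContinuousLinearMap.isSelfAdjoint_iff_isSymmetric]
  intro x y
  change inner ℂ (opDiag D x) y = inner ℂ x (opDiag D y)
  rw [PiLp.inner_apply, PiLp.inner_apply]
  refine Finset.sum_congr rfl fun i _ => ?_
  rw [opDiag_apply, opDiag_apply]
  exact (ContinuousLinearMap.isSelfAdjoint_iff_isSymmetric.1 (hD i)) (x i) (y i)

end OperatorMatrices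

section Symbols

/-- Matrix-valued symbols: `m × m` matrices of `n × n` matrices of bounded measurable functions. -/
abbrev MatSymbol (Λ : Type*) [MeasurableSpace Λ] (m n : ℕ) : Type _ :=
  Matrix (Fin m) (Fin m) (Matrix (Fin n) (Fin n) (BddFun Λ))

variable {Λ : Type*} [MeasurableSpace Λ] {m n : ℕ}

/-- Evaluation of a bounded measurable function at a point. -/
def evalFun (x : Λ) : BddFun Λ →+* ℂ :=
  (Pi.evalRingHom (fun _ : Λ => ℂ) x).comp (BddFun Λ).val.toRingHom

theorem evalFun_apply (x : Λ) (f : BddFun Λ) : evalFun x f = (f : Λ → ℂ) x := rfl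

/-- Evaluation of a matrix of bounded measurable functions at a point. -/
def evalMat (x : Λ) : Matrix (Fin n) (Fin n) (BddFun Λ) →+* Matrix (Fin n) (Fin n) ℂ :=
  (evalFun x).mapMatrix

/-- Evaluation of a symbol at a point. -/
def evalSym (x : Λ) : MatSymbol Λ m n →+* Matrix (Fin m) (Fin m) (Matrix (Fin n) (Fin n) ℂ) :=
  (evalMat x).mapMatrix

theorem evalMat_apply (x : Λ) (A : Matrix (Fin n) (Fin n) (BddFun Λ)) (i j : Fin n) :
    evalMat x A i j = (A i j : Λ → ℂ) x := rfl

theorem evalSym_apply (x : Λ) (F : MatSymbol Λ m n) (i j : Fin m) :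
    evalSym x F i j = evalMat x (F i j) := rfl

theorem evalMat_injective {A B : Matrix (Fin n) (Fin n) (BddFun Λ)}
    (h : ∀ x, evalMat x A = evalMat x B) : A = B := by
  refine Matrix.ext fun i j => ?_
  apply Subtype.ext
  funext x
  exact congrFun (congrFun (h x) i) j

theorem evalSym_injective {F G : MatSymbol Λ m n} (h : ∀ x, evalSym x F = evalSym x G) : F = G := by
  refine Matrix.ext fun i j => ?_
  exact evalMat_injective fun x => congrFun (congrFun (h x) i) j

/-- The operator on `L²(μ)^{(n)}` with a given matrix of bounded measurable functions. -/
noncomputable def matOp (μ : Measure Λ) (n : ℕ) :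
    Matrix (Fin n) (Fin n) (BddFun Λ) →+*
      (HilbertPow n (Lp ℂ 2 μ) →L[ℂ] HilbertPow n (Lp ℂ 2 μ)) :=
  (opMatrixEquiv n (Lp ℂ 2 μ)).toRingHom.comp (mulHom μ).mapMatrix

/-- The operator on `(L²(μ)^{(n)})^{(m)}` with a given symbol. -/
noncomputable def symOp (μ : Measure Λ) (m n : ℕ) :
    MatSymbol Λ m n →+* (HilbertPow m (HilbertPow n (Lp ℂ 2 μ)) →L[ℂ]
      HilbertPow m (HilbertPow n (Lp ℂ 2 μ))) :=
  (opMatrixEquiv m (HilbertPow n (Lp ℂ 2 μ))).toRingHom.comp (matOp μ n).mapMatrix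

variable {μ : Measure Λ}

theorem matOp_apply (A : Matrix (Fin n) (Fin n) (BddFun Λ)) :
    matOp μ n A = opMatrix (A.map (mulHom μ)) := rfl

theorem symOp_apply (F : MatSymbol Λ m n) : symOp μ m n F = opMatrix (F.map (matOp μ n)) := rfl

theorem matOp_eq_iff [SigmaFinite μ] {A B : Matrix (Fin n) (Fin n) (BddFun Λ)} :
    matOp μ n A = matOp μ n B ↔ ∀ᵐ x ∂μ, evalMat x A = evalMat x B := by
  rw [matOp_apply, matOp_apply, ← opMatrixEquiv_apply, ← opMatrixEquiv_apply,
    (opMatrixEquiv n (Lp ℂ 2 μ)).injective.eq_iff]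
  constructor
  · intro h
    have : ∀ i j, ∀ᵐ x ∂μ, (A i j : Λ → ℂ) x = (B i j : Λ → ℂ) x := fun i j =>
      mulHom_eq_iff.1 (congrFun (congrFun h i) j)
    filter_upwards [ae_all_iff.2 fun i => ae_all_iff.2 (this i)] with x hx
    ext i j
    exact hx i j
  · intro h
    refine Matrix.ext fun i j => ?_
    apply mulHom_congr
    filter_upwards [h] with x hx
    exact congrFun (congrFun hx i) j

theorem symOp_eq_iff [SigmaFinite μ] {F G : MatSymbol Λ m n} :
    symOp μ m n F = symOp μ m n G ↔ ∀ᵐ x ∂μ, evalSym x F = evalSym x G := by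
  rw [symOp_apply, symOp_apply, ← opMatrixEquiv_apply, ← opMatrixEquiv_apply,
    (opMatrixEquiv m _).injective.eq_iff]
  constructor
  · intro h
    have : ∀ i j, ∀ᵐ x ∂μ, evalMat x (F i j) = evalMat x (G i j) := fun i j =>
      matOp_eq_iff.1 (congrFun (congrFun h i) j)
    filter_upwards [ae_all_iff.2 fun i => ae_all_iff.2 (this i)] with x hx
    refine Matrix.ext fun i j => ?_
    exact hx i j
  · intro h
    refine Matrix.ext fun i j => ?_
    apply matOp_eq_iff.2
    filter_upwards [h] with x hx
    exact congrFun (congrFun hx i) j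

theorem ae_norm_le_norm_symOp [SigmaFinite μ] (F : MatSymbol Λ m n) :
    ∀ᵐ x ∂μ, ∀ i j a b, ‖evalSym x F i j a b‖ ≤ ‖symOp μ m n F‖ := by
  simp only [ae_all_iff]
  intro i j a b
  have h1 : ‖mulHom μ (F i j a b)‖ ≤ ‖symOp μ m n F‖ :=
    (norm_opMatrix_entry_le ((F i j).map (mulHom μ)) a b).trans
      (norm_opMatrix_entry_le (F.map (matOp μ n)) i j)
  filter_upwards [ae_norm_le_norm_mulHom (μ := μ) (F i j a b)] with x hx
  exact hx.trans h1

theorem measurable_evalSym (F : MatSymbol Λ m n) (i j : Fin m) (a b : Fin n) :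
    Measurable fun x => evalSym x F i j a b := (F i j a b).2.1

/-- A matrix-valued function with measurable, uniformly bounded entries is a symbol. -/
theorem exists_symbol {f : Λ → Matrix (Fin m) (Fin m) (Matrix (Fin n) (Fin n) ℂ)}
    (hf : ∀ i j a b, Measurable fun x => f x i j a b) {C : ℝ}
    (hC : ∀ x i j a b, ‖f x i j a b‖ ≤ C) : ∃ F : MatSymbol Λ m n, ∀ x, evalSym x F = f x :=
  ⟨fun i j a b => ⟨fun x => f x i j a b, hf i j a b, C, fun x => hC x i j a b⟩, fun _ => rfl⟩

theorem exists_symbol_bound (F : MatSymbol Λ m n) :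
    ∃ C : ℝ, ∀ x i j a b, ‖evalSym x F i j a b‖ ≤ C := by
  choose C hC using fun i j a b => (F i j a b).2.2
  refine ⟨∑ i, ∑ j, ∑ a, ∑ b, |C i j a b|, fun x i j a b => ?_⟩
  calc ‖evalSym x F i j a b‖ ≤ |C i j a b| := (hC i j a b x).trans (le_abs_self _)
    _ ≤ ∑ b, |C i j a b| :=
      Finset.single_le_sum (f := fun b => |C i j a b|) (fun _ _ => abs_nonneg _)
        (Finset.mem_univ b)
    _ ≤ ∑ a, ∑ b, |C i j a b| :=
      Finset.single_le_sum (f := fun a => ∑ b, |C i j a b|)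
        (fun _ _ => Finset.sum_nonneg fun _ _ => abs_nonneg _) (Finset.mem_univ a)
    _ ≤ ∑ j, ∑ a, ∑ b, |C i j a b| :=
      Finset.single_le_sum (f := fun j => ∑ a, ∑ b, |C i j a b|)
        (fun _ _ => Finset.sum_nonneg fun _ _ => Finset.sum_nonneg fun _ _ => abs_nonneg _)
        (Finset.mem_univ j)
    _ ≤ _ :=
      Finset.single_le_sum (f := fun i => ∑ j, ∑ a, ∑ b, |C i j a b|)
        (fun _ _ => Finset.sum_nonneg fun _ _ => Finset.sum_nonneg fun _ _ =>
          Finset.sum_nonneg fun _ _ => abs_nonneg _) (Finset.mem_univ i)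

end Symbols

/-! ### Matrices commuting with a Jordan-like matrix -/

section Pointwise

variable {n : ℕ}

/-- A strictly upper triangular matrix with nonvanishing superdiagonal, i.e. an upper triangular
matrix similar to a single nilpotent Jordan block. -/
structure IsJordanLike (N : Matrix (Fin n) (Fin n) ℂ) : Prop where
  strictUpper : ∀ i j, j ≤ i → N i j = 0
  superdiag : ∀ i j : Fin n, (i : ℕ) + 1 = j → N i j ≠ 0

variable {N X Y : Matrix (Fin n) (Fin n) ℂ}

/-- The kernels of the powers of `N` are the coordinate flag, and a matrix commuting with `N`
preserves them. -/
theorem IsJordanLike.upper_of_commute (hN : IsJordanLike N) (h : Commute X N) :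
    ∀ i j, j < i → X i j = 0 := by
  suffices H : ∀ (b : ℕ) (j : Fin n), (j : ℕ) = b → ∀ i, j < i → X i j = 0 from
    fun i j => H j j rfl i
  intro b
  induction b using Nat.strong_induction_on with
  | _ b ih =>
    intro j hj
    have h0 : ∀ i, j ≤ i → ∑ l, N i l * X l j = 0 := by
      intro i hi
      rw [← Matrix.mul_apply, ← h.eq, Matrix.mul_apply]
      refine Finset.sum_eq_zero fun l _ => ?_
      by_cases hl : j ≤ l
      · rw [hN.strictUpper l j hl, mul_zero]
      · push Not at hl
        rw [ih l (hj ▸ hl) l rfl i (hl.trans_le hi), zero_mul]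
    -- back substitution in `N y = 0`, from the last row upwards
    have h1 : ∀ (d : ℕ) (i : Fin n), n - (i : ℕ) = d → j < i → X i j = 0 := by
      intro d
      induction d using Nat.strong_induction_on with
      | _ d ihd =>
        intro i hd hji
        have hlt : (j : ℕ) < i := hji
        let p : Fin n := ⟨(i : ℕ) - 1, by omega⟩
        have hp : (p : ℕ) + 1 = i := by change (i : ℕ) - 1 + 1 = i; omega
        have hs := h0 p (by rw [Fin.le_def]; omega)
        rw [Finset.sum_eq_single i] at hs
        · exact (mul_eq_zero.1 hs).resolve_left (hN.superdiag p i hp)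
        · intro l _ hl
          rcases lt_or_gt_of_ne hl with hl | hl
          · rw [hN.strictUpper p l (by rw [Fin.le_def]; rw [Fin.lt_def] at hl; omega), zero_mul]
          · have hl' : (i : ℕ) < l := hl
            rw [ihd (n - l) (by omega) l rfl (hji.trans hl), mul_zero]
        · simp
    exact fun i => h1 _ i rfl

theorem IsJordanLike.diag_of_commute [NeZero n] (hN : IsJordanLike N) (h : Commute X N)
    (i : Fin n) :
    X i i = X 0 0 := by
  have hX := hN.upper_of_commute h
  suffices H : ∀ (b : ℕ) (i : Fin n), (i : ℕ) = b → X i i = X 0 0 from H i i rfl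
  intro b
  induction b with
  | zero =>
    intro i hi
    have : i = 0 := Fin.ext hi
    rw [this]
  | succ b ih =>
    intro i hi
    let p : Fin n := ⟨b, by omega⟩
    have hpi : (p : ℕ) + 1 = i := hi.symm
    rw [← ih p rfl]
    have h1 := congrFun (congrFun h.eq p) i
    rw [Matrix.mul_apply, Matrix.mul_apply, Finset.sum_eq_single p, Finset.sum_eq_single i] at h1
    · rw [mul_comm] at h1
      exact (mul_left_cancel₀ (hN.superdiag p i hpi) h1).symm
    · intro l _ hl
      rcases lt_or_gt_of_ne hl with hl | hl
      · rw [hN.strictUpper p l (by rw [Fin.le_def]; rw [Fin.lt_def] at hl; omega), zero_mul]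
      · rw [hX l i hl, mul_zero]
    · simp
    · intro l _ hl
      rcases lt_or_gt_of_ne hl with hl | hl
      · rw [hX p l hl, zero_mul]
      · rw [hN.strictUpper l i (by rw [Fin.le_def]; rw [Fin.lt_def] at hl; omega), mul_zero]
    · simp

theorem IsJordanLike.det_of_commute [NeZero n] (hN : IsJordanLike N) (h : Commute X N) :
    X.det = X 0 0 ^ n := by
  have hX : X.BlockTriangular id := fun i j hij => hN.upper_of_commute h i j hij
  rw [Matrix.det_of_isUpperTriangular hX, Finset.prod_congr rfl fun i _ => hN.diag_of_commute h i]
  simp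

theorem IsJordanLike.mul_zero_zero [NeZero n] (hN : IsJordanLike N) (h : Commute Y N) :
    (X * Y) 0 0 = X 0 0 * Y 0 0 := by
  rw [Matrix.mul_apply, Finset.sum_eq_single 0]
  · intro l _ hl
    rw [hN.upper_of_commute h l 0 (Fin.pos_iff_ne_zero.2 hl), mul_zero]
  · simp

variable {m : ℕ}

/-- All blocks of `F` commute with `N`. -/
def BlocksCommute (N : Matrix (Fin n) (Fin n) ℂ)
    (F : Matrix (Fin m) (Fin m) (Matrix (Fin n) (Fin n) ℂ)) : Prop :=
  ∀ i j, Commute (F i j) N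

/-- The matrix of leading entries of the blocks. On matrices whose blocks commute with a
Jordan-like matrix it is the reduction modulo the nilpotent radical. -/
def lead [NeZero n] (F : Matrix (Fin m) (Fin m) (Matrix (Fin n) (Fin n) ℂ)) :
    Matrix (Fin m) (Fin m) ℂ := F.map fun X => X 0 0

/-- The rank of an idempotent block matrix, over the local ring of matrices commuting with `N`:
the trace of its reduction modulo the radical, converted to a natural number. -/
noncomputable def leadRank [NeZero n] (F : Matrix (Fin m) (Fin m) (Matrix (Fin n) (Fin n) ℂ)) : ℕ :=
  ⌊(lead F).trace.re⌋₊

variable {F G : Matrix (Fin m) (Fin m) (Matrix (Fin n) (Fin n) ℂ)}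

theorem BlocksCommute.mul (hF : BlocksCommute N F) (hG : BlocksCommute N G) :
    BlocksCommute N (F * G) := fun i j => by
  rw [Matrix.mul_apply]
  exact Commute.sum_left _ _ _ fun l _ => (hF i l).mul_left (hG l j)

theorem BlocksCommute.sub (hF : BlocksCommute N F) (hG : BlocksCommute N G) :
    BlocksCommute N (F - G) := fun i j => (hF i j).sub_left (hG i j)

theorem blocksCommute_zero : BlocksCommute N (0 : Matrix (Fin m) (Fin m) _) :=
  fun _ _ => Commute.zero_left _

theorem blocksCommute_one : BlocksCommute N (1 : Matrix (Fin m) (Fin m) _) := fun i j => by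
  rw [Matrix.one_apply]
  split_ifs
  · exact Commute.one_left _
  · exact Commute.zero_left _

variable [NeZero n]

theorem IsJordanLike.lead_mul (hN : IsJordanLike N) (hG : BlocksCommute N G) :
    lead (F * G) = lead F * lead G := by
  ext i j
  simp only [lead, Matrix.map_apply, Matrix.mul_apply, Matrix.sum_apply]
  refine Finset.sum_congr rfl fun l _ => ?_
  rw [← Matrix.mul_apply]
  exact hN.mul_zero_zero (hG l j)

theorem lead_sub : lead (F - G) = lead F - lead G := by
  ext i j
  simp [lead]

theorem lead_one : lead (1 : Matrix (Fin m) (Fin m) (Matrix (Fin n) (Fin n) ℂ)) = 1 := by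
  ext i j
  simp only [lead, Matrix.map_apply, Matrix.one_apply]
  split_ifs <;> simp

theorem lead_zero : lead (0 : Matrix (Fin m) (Fin m) (Matrix (Fin n) (Fin n) ℂ)) = 0 := by
  ext i j
  simp [lead]

theorem IsJordanLike.cast_leadRank (hN : IsJordanLike N) (hF : BlocksCommute N F)
    (h : IsIdempotentElem F) : (leadRank F : ℂ) = (lead F).trace := by
  have h1 : IsIdempotentElem (Matrix.toLin' (lead F)) := by
    rw [IsIdempotentElem, Module.End.mul_eq_comp, ← Matrix.toLin'_mul, ← hN.lead_mul hF, h.eq]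
  have h2 := (LinearMap.IsIdempotentElem.isProj_range _ h1).trace
  rw [Matrix.trace_toLin'_eq] at h2
  rw [leadRank, h2]
  simp

/-- The blocks of an idempotent in the radical lie in every power of the radical. -/
theorem IsJordanLike.eq_zero_of_lead_eq_zero (hN : IsJordanLike N) (hF : BlocksCommute N F)
    (h : IsIdempotentElem F) (h0 : lead F = 0) : F = 0 := by
  have key : ∀ d : ℕ, ∀ (i j : Fin m) (a b : Fin n), (b : ℕ) ≤ a + d → F i j a b = 0 := by
    intro d
    induction d with
    | zero =>
      intro i j a b hab
      rcases (show b ≤ a from hab).eq_or_lt with rfl | hlt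
      · rw [hN.diag_of_commute (hF i j)]
        exact congrFun (congrFun h0 i) j
      · exact hN.upper_of_commute (hF i j) a b hlt
    | succ d ih =>
      intro i j a b hab
      rw [← h.eq, Matrix.mul_apply, Matrix.sum_apply]
      refine Finset.sum_eq_zero fun l _ => ?_
      rw [Matrix.mul_apply]
      refine Finset.sum_eq_zero fun c _ => ?_
      by_cases hc : (c : ℕ) ≤ a + d
      · rw [ih i l a c hc, zero_mul]
      · rw [ih l j c b (by omega), mul_zero]
  ext i j a b
  exact key n i j a b (by omega)

theorem IsJordanLike.eq_zero_of_leadRank_eq_zero (hN : IsJordanLike N) (hF : BlocksCommute N F)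
    (h : IsIdempotentElem F) (h0 : leadRank F = 0) : F = 0 := by
  apply hN.eq_zero_of_lead_eq_zero hF h
  have h1 : IsIdempotentElem (Matrix.toLin' (lead F)) := by
    rw [IsIdempotentElem, Module.End.mul_eq_comp, ← Matrix.toLin'_mul, ← hN.lead_mul hF, h.eq]
  have h2 := hN.cast_leadRank hF h
  rw [h0, Nat.cast_zero, ← Matrix.trace_toLin'_eq] at h2
  have h3 := LinearMap.IsIdempotentElem.eq_zero_of_trace_eq_zero h1 h2.symm
  simpa using h3

theorem leadRank_zero : leadRank (0 : Matrix (Fin m) (Fin m) (Matrix (Fin n) (Fin n) ℂ)) = 0 := by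
  simp [leadRank, lead_zero]

theorem leadRank_one : leadRank (1 : Matrix (Fin m) (Fin m) (Matrix (Fin n) (Fin n) ℂ)) = m := by
  simp [leadRank, lead_one]

theorem isIdempotentElem_sub {R : Type*} [Ring R] {p q : R} (hp : IsIdempotentElem p)
    (hq : IsIdempotentElem q) (h1 : p * q = q) (h2 : q * p = q) : IsIdempotentElem (p - q) := by
  rw [IsIdempotentElem, mul_sub, sub_mul, sub_mul, hp.eq, hq.eq, h1, h2]
  abel

theorem IsJordanLike.leadRank_sub_add (hN : IsJordanLike N) (hF : BlocksCommute N F)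
    (hG : BlocksCommute N G) (hFi : IsIdempotentElem F) (hGi : IsIdempotentElem G)
    (h1 : F * G = G) (h2 : G * F = G) : leadRank (F - G) + leadRank G = leadRank F := by
  have h := hN.cast_leadRank (hF.sub hG) (isIdempotentElem_sub hFi hGi h1 h2)
  rw [lead_sub, Matrix.trace_sub, ← hN.cast_leadRank hF hFi, ← hN.cast_leadRank hG hGi] at h
  have h3 : ((leadRank (F - G) + leadRank G : ℕ) : ℂ) = (leadRank F : ℕ) := by
    push_cast
    rw [h]
    ring
  exact_mod_cast h3

theorem IsJordanLike.leadRank_le (hN : IsJordanLike N) (hF : BlocksCommute N F)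
    (hG : BlocksCommute N G) (hFi : IsIdempotentElem F) (hGi : IsIdempotentElem G)
    (h1 : F * G = G) (h2 : G * F = G) : leadRank G ≤ leadRank F := by
  have := hN.leadRank_sub_add hF hG hFi hGi h1 h2
  omega

theorem IsJordanLike.eq_of_leadRank_le (hN : IsJordanLike N) (hF : BlocksCommute N F)
    (hG : BlocksCommute N G) (hFi : IsIdempotentElem F) (hGi : IsIdempotentElem G)
    (h1 : F * G = G) (h2 : G * F = G) (h : leadRank F ≤ leadRank G) : G = F := by
  have h3 := hN.leadRank_sub_add hF hG hFi hGi h1 h2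
  have h4 := hN.eq_zero_of_leadRank_eq_zero (hF.sub hG) (isIdempotentElem_sub hFi hGi h1 h2)
    (by omega)
  exact (sub_eq_zero.1 h4).symm

theorem IsJordanLike.exists_le_norm_lead (hN : IsJordanLike N) (hF : BlocksCommute N F)
    (h : IsIdempotentElem F) (h0 : F ≠ 0) : ∃ i, (m : ℝ)⁻¹ ≤ ‖F i i 0 0‖ := by
  by_contra! hcon
  have h1 : 1 ≤ leadRank F := by
    by_contra hlt
    exact h0 (hN.eq_zero_of_leadRank_eq_zero hF h (by omega))
  have h2 : (1 : ℝ) ≤ ‖(lead F).trace‖ := by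
    rw [← hN.cast_leadRank hF h, Complex.norm_natCast]
    exact_mod_cast h1
  have hm : 0 < m := by
    rcases Nat.eq_zero_or_pos m with rfl | hm
    · exact absurd (Matrix.ext fun i => i.elim0) h0
    · exact hm
  have h3 : ‖(lead F).trace‖ < 1 := by
    have : Nonempty (Fin m) := ⟨⟨0, hm⟩⟩
    calc ‖(lead F).trace‖ ≤ ∑ i, ‖F i i 0 0‖ := norm_sum_le _ _
      _ < ∑ _i : Fin m, (m : ℝ)⁻¹ :=
        Finset.sum_lt_sum_of_nonempty Finset.univ_nonempty fun i _ => hcon i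
      _ = 1 := by
        rw [Finset.sum_const, Finset.card_univ, Fintype.card_fin, nsmul_eq_mul]
        exact mul_inv_cancel₀ (by exact_mod_cast hm.ne')
  linarith

end Pointwise

/-! ### The commutant of the upper triangular operator and of its ampliation -/

section InnerDerivations

variable {A : Type*} [Ring A] [Algebra ℂ A]

theorem innerDer_add (M M' : A) : innerDer (M + M') = innerDer M + innerDer M' := by
  ext X
  simp only [innerDer_apply, LinearMap.add_apply]
  noncomm_ring

theorem commute_innerDer {M M' : A} (h : Commute M M') : Commute (innerDer M) (innerDer M') := by
  ext X
  simp only [Module.End.mul_apply, innerDer_apply, mul_sub, sub_mul]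
  have h1 : M * (M' * X) = M' * (M * X) := by rw [← mul_assoc, h.eq, mul_assoc]
  have h2 : X * (M' * M) = X * (M * M') := by rw [h.eq]
  simp only [mul_assoc]
  rw [h1, h2]
  abel

theorem isNilpotent_innerDer {M : A} (h : IsNilpotent M) : IsNilpotent (innerDer M) :=
  (LinearMap.commute_mulLeft_right (R := ℂ) M M).isNilpotent_sub
    ((LinearMap.isNilpotent_mulLeft_iff ℂ M).2 h) ((LinearMap.isNilpotent_mulRight_iff ℂ M).2 h)

theorem pow_sub_apply_of_apply_eq_zero {V : Type*} [AddCommGroup V] [Module ℂ V]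
    {S U : Module.End ℂ V} (h : Commute S U) {b : V} (hb : S b = 0) (k : ℕ) :
    ((S - U) ^ k) b = ((-U) ^ k) b := by
  induction k with
  | zero => rfl
  | succ k ih =>
    have hc : Commute ((S - U) ^ k) (-U) :=
      ((h.sub_left (Commute.refl U)).pow_left k).neg_right
    rw [pow_succ, Module.End.mul_apply, LinearMap.sub_apply, hb, zero_sub, ← LinearMap.neg_apply,
      ← Module.End.mul_apply, hc.eq, Module.End.mul_apply, ih, ← Module.End.mul_apply, ← pow_succ']

/-- An element commuting with the sum of `D` and a nilpotent commuting with `D` is annihilated by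
a power of the inner derivation of `D`. -/
theorem exists_innerDer_pow_eq_zero {D N b : A} (hDN : Commute D N) (hN : IsNilpotent N)
    (h : Commute b (D + N)) : ∃ k, (innerDer D ^ k) b = 0 := by
  obtain ⟨k, hk⟩ := (isNilpotent_innerDer hN).neg
  refine ⟨k, ?_⟩
  have h1 : innerDer D = innerDer (D + N) - innerDer N := by rw [innerDer_add]; abel
  have h2 : innerDer (D + N) b = 0 := by rw [innerDer_apply, h.eq, sub_self]
  rw [h1, pow_sub_apply_of_apply_eq_zero
    (commute_innerDer (hDN.add_left (Commute.refl N))) h2, hk]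
  rfl

theorem innerDer_diagonal_pow_apply {n : ℕ} (a : A) (k : ℕ) (b : Matrix (Fin n) (Fin n) A)
    (i j : Fin n) :
    (innerDer (Matrix.diagonal fun _ => a) ^ k) b i j = (innerDer a ^ k) (b i j) := by
  induction k generalizing b with
  | zero => rfl
  | succ k ih =>
    rw [pow_succ, Module.End.mul_apply, ih, pow_succ, Module.End.mul_apply, innerDer_apply,
      innerDer_apply, Matrix.sub_apply, Matrix.diagonal_mul, Matrix.mul_diagonal]

end InnerDerivations

section Commutant

variable {Λ : Type*} [MeasurableSpace Λ] {μ : Measure Λ} {m n : ℕ}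

theorem IsJordanLike.pow_eq_zero {N : Matrix (Fin n) (Fin n) ℂ} (hN : IsJordanLike N) :
    N ^ n = 0 := by
  have key : ∀ (d : ℕ) (a b : Fin n), (b : ℕ) < a + d → (N ^ d) a b = 0 := by
    intro d
    induction d with
    | zero =>
      intro a b hab
      rw [pow_zero, Matrix.one_apply_ne]
      rintro rfl
      omega
    | succ d ih =>
      intro a b hab
      rw [pow_succ, Matrix.mul_apply]
      refine Finset.sum_eq_zero fun c _ => ?_
      by_cases hc : (c : ℕ) < a + d
      · rw [ih a c hc, zero_mul]
      · rw [hN.strictUpper c b (by rw [Fin.le_def]; omega), mul_zero]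
  ext a b
  exact key n a b (by omega)

theorem isNilpotent_of_isJordanLike {N : Matrix (Fin n) (Fin n) (BddFun Λ)}
    (hN : ∀ x, IsJordanLike (evalMat x N)) : IsNilpotent N := by
  refine ⟨n, evalMat_injective fun x => ?_⟩
  rw [map_pow, map_zero, (hN x).pow_eq_zero]

/-- Operators commuting with `M_φ ⊕ ⋯ ⊕ M_φ + N` are matrices of multiplication operators. -/
theorem exists_matOp_of_commute [StandardBorelSpace Λ] [SigmaFinite μ] {φ : BddFun Λ}
    {s : Set Λ} (hs : μ sᶜ = 0) (hφ : Set.InjOn (φ : Λ → ℂ) s)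
    {N : Matrix (Fin n) (Fin n) (BddFun Λ)} (hN : ∀ x, IsJordanLike (evalMat x N))
    {B : HilbertPow n (Lp ℂ 2 μ) →L[ℂ] HilbertPow n (Lp ℂ 2 μ)}
    (hB : Commute B (matOp μ n (Matrix.diagonal (fun _ => φ) + N))) :
    ∃ A, matOp μ n A = B := by
  obtain ⟨b, rfl⟩ := (opMatrixEquiv n (Lp ℂ 2 μ)).surjective B
  have hb : Commute b ((mulHom μ).mapMatrix (Matrix.diagonal (fun _ => φ) + N)) :=
    (opMatrixEquiv n (Lp ℂ 2 μ)).injective (by rw [map_mul, map_mul]; exact hB.eq)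
  have hD : (mulHom μ).mapMatrix (Matrix.diagonal fun _ : Fin n => φ) =
      Matrix.diagonal fun _ => mulHom μ φ := by
    rw [RingHom.mapMatrix_apply, Matrix.diagonal_map (map_zero _)]
  have hcomm : Commute (Matrix.diagonal fun _ : Fin n => φ) N :=
    Matrix.ext fun i j => by
      rw [Matrix.diagonal_mul, Matrix.mul_diagonal, mul_comm]
  rw [map_add] at hb
  obtain ⟨k, hk⟩ := exists_innerDer_pow_eq_zero (hcomm.map (mulHom μ).mapMatrix)
    ((isNilpotent_of_isJordanLike hN).map (mulHom μ).mapMatrix) hb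
  rw [hD] at hk
  have hent : ∀ i j, ∃ f, mulHom μ f = b i j := fun i j =>
    exists_mulHom_of_innerDer_pow_eq_zero hs hφ (k := k)
      (by rw [← innerDer_diagonal_pow_apply, hk]; rfl)
  choose f hf using hent
  refine ⟨Matrix.of f, ?_⟩
  rw [matOp_apply, ← opMatrixEquiv_apply]
  congr 1
  exact Matrix.ext hf

/-- A symbol whose blocks commute everywhere with the matrix function `N`. -/
def SymCommutes (N : Matrix (Fin n) (Fin n) (BddFun Λ)) (F : MatSymbol Λ m n) : Prop :=
  ∀ x, BlocksCommute (evalMat x N) (evalSym x F)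

theorem evalMat_diagonal_const (x : Λ) (φ : BddFun Λ) :
    evalMat x (Matrix.diagonal fun _ : Fin n => φ) = algebraMap ℂ _ ((φ : Λ → ℂ) x) := by
  rw [Matrix.algebraMap_eq_diagonal]
  change ((Matrix.diagonal fun _ : Fin n => φ).map (evalFun x)) = _
  rw [Matrix.diagonal_map (map_zero _)]
  rfl

theorem commute_evalMat_diagonal_add_iff {φ : BddFun Λ} {N A : Matrix (Fin n) (Fin n) (BddFun Λ)}
    {x : Λ} : Commute (evalMat x A) (evalMat x (Matrix.diagonal (fun _ => φ) + N)) ↔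
      Commute (evalMat x A) (evalMat x N) := by
  rw [map_add, evalMat_diagonal_const]
  have h := (Algebra.commutes ((φ : Λ → ℂ) x) (evalMat x A)).symm
  constructor
  · intro h1
    have := h1.sub_right (show Commute _ _ from h)
    rwa [add_sub_cancel_left] at this
  · exact fun h1 => Commute.add_right h h1

theorem ampliation_matOp (A : Matrix (Fin n) (Fin n) (BddFun Λ)) :
    ampliation (matOp μ n A) m = symOp μ m n (Matrix.diagonal fun _ => A) := by
  rw [symOp_apply, Matrix.diagonal_map (map_zero _)]
  rfl

theorem mem_commutant_ampliation_of_symCommutes {φ : BddFun Λ}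
    {N : Matrix (Fin n) (Fin n) (BddFun Λ)} {F : MatSymbol Λ m n} (hF : SymCommutes N F) :
    symOp μ m n F ∈ commutant
      (ampliation (matOp μ n (Matrix.diagonal (fun _ => φ) + N)) m) := by
  rw [ampliation_matOp]
  change _ * _ = _ * _
  rw [← map_mul, ← map_mul]
  congr 1
  refine Matrix.ext fun i j => ?_
  rw [Matrix.diagonal_mul, Matrix.mul_diagonal]
  refine evalMat_injective fun x => ?_
  rw [map_mul, map_mul]
  exact (commute_evalMat_diagonal_add_iff.2 (hF x i j)).eq.symm

theorem measurableSet_evalMat_eq (A B : Matrix (Fin n) (Fin n) (BddFun Λ)) :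
    MeasurableSet {x | evalMat x A = evalMat x B} := by
  have : {x | evalMat x A = evalMat x B} =
      ⋂ i, ⋂ j, {x | (A i j : Λ → ℂ) x = (B i j : Λ → ℂ) x} := by
    ext x
    simp only [Set.mem_iInter]
    exact ⟨fun h i j => congrFun (congrFun h i) j, fun h => Matrix.ext h⟩
  rw [this]
  exact MeasurableSet.iInter fun i => MeasurableSet.iInter fun j =>
    measurableSet_eq_fun (A i j).2.1 (B i j).2.1

theorem measurableSet_evalSym_eq (F G : MatSymbol Λ m n) :
    MeasurableSet {x | evalSym x F = evalSym x G} := by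
  have : {x | evalSym x F = evalSym x G} =
      ⋂ i, ⋂ j, {x | evalMat x (F i j) = evalMat x (G i j)} := by
    ext x
    simp only [Set.mem_iInter]
    exact ⟨fun h i j => congrFun (congrFun h i) j, fun h => Matrix.ext h⟩
  rw [this]
  exact MeasurableSet.iInter fun i => MeasurableSet.iInter fun j => measurableSet_evalMat_eq _ _

/-- The symbol `F` cut off to a measurable set. -/
theorem exists_symbol_indicator (F : MatSymbol Λ m n) {S : Set Λ} (hS : MeasurableSet S) :
    ∃ G : MatSymbol Λ m n, (∀ x ∈ S, evalSym x G = evalSym x F) ∧ ∀ x ∉ S, evalSym x G = 0 := by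
  refine ⟨F.map fun A => A.map fun f => indFun S hS * f, fun x hx => ?_, fun x hx => ?_⟩
  · ext i j a b
    change (indFun S hS : Λ → ℂ) x * (F i j a b : Λ → ℂ) x = _
    rw [indFun_of_mem hS hx, one_mul]
    rfl
  · ext i j a b
    change (indFun S hS : Λ → ℂ) x * (F i j a b : Λ → ℂ) x = _
    rw [indFun_of_notMem hS hx, zero_mul]
    rfl

/-- The commutant of the ampliation consists of the operators whose symbol has all blocks
commuting with `N`. -/
theorem exists_symbol_of_mem_commutant [StandardBorelSpace Λ] [SigmaFinite μ] {φ : BddFun Λ}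
    {s : Set Λ} (hs : μ sᶜ = 0) (hφ : Set.InjOn (φ : Λ → ℂ) s)
    {N : Matrix (Fin n) (Fin n) (BddFun Λ)} (hN : ∀ x, IsJordanLike (evalMat x N))
    {B : HilbertPow m (HilbertPow n (Lp ℂ 2 μ)) →L[ℂ] HilbertPow m (HilbertPow n (Lp ℂ 2 μ))}
    (hB : B ∈ commutant (ampliation (matOp μ n (Matrix.diagonal (fun _ => φ) + N)) m)) :
    ∃ F : MatSymbol Λ m n, SymCommutes N F ∧ symOp μ m n F = B := by
  obtain ⟨b, rfl⟩ := (opMatrixEquiv m (HilbertPow n (Lp ℂ 2 μ))).surjective B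
  set T := matOp μ n (Matrix.diagonal (fun _ => φ) + N) with hT
  have hb : (Matrix.diagonal fun _ => T) * b = b * Matrix.diagonal fun _ => T :=
    (opMatrixEquiv m _).injective (by rw [map_mul, map_mul]; exact hB)
  have hent : ∀ i j, Commute (b i j) T := fun i j => by
    have := congrFun (congrFun hb i) j
    rw [Matrix.diagonal_mul, Matrix.mul_diagonal] at this
    exact this.symm
  choose f hf using fun i j => exists_matOp_of_commute hs hφ hN (hent i j)
  have hae : ∀ i j, ∀ᵐ x ∂μ, Commute (evalMat x (f i j)) (evalMat x N) := by
    intro i j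
    have h1 := hent i j
    rw [← hf i j, hT, Commute, SemiconjBy, ← map_mul, ← map_mul, matOp_eq_iff] at h1
    filter_upwards [h1] with x hx
    rw [map_mul, map_mul] at hx
    exact commute_evalMat_diagonal_add_iff.1 hx
  have hS : MeasurableSet {x | evalSym x (Matrix.of f * Matrix.diagonal fun _ => N) =
      evalSym x ((Matrix.diagonal fun _ => N) * Matrix.of f)} := measurableSet_evalSym_eq _ _
  have hSiff : ∀ x, evalSym x (Matrix.of f * Matrix.diagonal fun _ => N) =
      evalSym x ((Matrix.diagonal fun _ => N) * Matrix.of f) ↔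
      ∀ i j, Commute (evalMat x (f i j)) (evalMat x N) := by
    intro x
    rw [← Matrix.ext_iff]
    refine forall_congr' fun i => forall_congr' fun j => ?_
    rw [evalSym_apply, evalSym_apply, Matrix.diagonal_mul, Matrix.mul_diagonal, map_mul, map_mul]
    rfl
  obtain ⟨F, hF1, hF2⟩ := exists_symbol_indicator (Matrix.of f) hS
  refine ⟨F, fun x => ?_, ?_⟩
  · by_cases hx : x ∈ {x | evalSym x (Matrix.of f * Matrix.diagonal fun _ => N) =
      evalSym x ((Matrix.diagonal fun _ => N) * Matrix.of f)}
    · rw [hF1 x hx]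
      exact fun i j => (hSiff x).1 hx i j
    · rw [hF2 x hx]
      exact blocksCommute_zero
  · have h1 : symOp μ m n F = symOp μ m n (Matrix.of f) := by
      rw [symOp_eq_iff]
      filter_upwards [ae_all_iff.2 fun i => ae_all_iff.2 (hae i)] with x hx
      exact hF1 x ((hSiff x).2 hx)
    rw [h1, symOp_apply, ← opMatrixEquiv_apply]
    congr 1
    exact Matrix.ext hf

/-- Everywhere defined representatives of the entries of the upper triangular operator. -/
theorem exists_upperTriangularOp_eq_matOp (φ : Lp ℂ ∞ μ) (Φ : Fin n → Fin n → Lp ℂ ∞ μ)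
    (hφ : ∃ s : Set Λ, μ sᶜ = 0 ∧ Set.InjOn φ s)
    (hΦ : ∀ i j : Fin n, (i : ℕ) + 1 = (j : ℕ) → ∀ᵐ x ∂μ, Φ i j x ≠ 0) :
    ∃ (ψ : BddFun Λ) (N : Matrix (Fin n) (Fin n) (BddFun Λ)),
      (∃ s : Set Λ, μ sᶜ = 0 ∧ Set.InjOn (ψ : Λ → ℂ) s) ∧
      (∀ x, IsJordanLike (evalMat x N)) ∧
      upperTriangularOp φ Φ = matOp μ n (Matrix.diagonal (fun _ => ψ) + N) := by
  obtain ⟨ψ, hψ, hψop⟩ := exists_mulHom_eq_mulOp φ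
  choose f hf hfop using fun i j => exists_mulHom_eq_mulOp (Φ i j)
  -- the superdiagonal entries are changed to `1` where they vanish
  have hZ : ∀ i j, MeasurableSet {x | (f i j : Λ → ℂ) x = 0} := fun i j =>
    measurableSet_eq_fun (f i j).2.1 measurable_const
  let g : Fin n → Fin n → BddFun Λ := fun i j =>
    if (i : ℕ) + 1 = j then f i j + indFun _ (hZ i j) else f i j
  have hgop : ∀ i j, mulHom μ (g i j) = mulOp (Φ i j) := by
    intro i j
    rw [← hfop i j]
    by_cases hij : (i : ℕ) + 1 = j
    · apply mulHom_congr
      filter_upwards [hf i j, hΦ i j hij] with x h1 h2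
      simp only [g, if_pos hij]
      change (f i j : Λ → ℂ) x + (indFun _ (hZ i j) : Λ → ℂ) x = _
      rw [indFun_of_notMem, add_zero]
      exact fun h => h2 (h1 ▸ h)
    · simp only [g, if_neg hij]
  refine ⟨ψ, Matrix.of fun i j => if i < j then g i j else 0, ?_, fun x => ⟨?_, ?_⟩, ?_⟩
  · obtain ⟨s, hs, hinj⟩ := hφ
    refine ⟨s ∩ {x | (ψ : Λ → ℂ) x = φ x}, ?_, ?_⟩
    · rw [Set.compl_inter]
      exact measure_union_null hs hψ
    · rintro x ⟨hx, hx'⟩ y ⟨hy, hy'⟩ hxy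
      rw [Set.mem_ofPred_eq] at hx' hy'
      exact hinj hx hy (hx' ▸ hy' ▸ hxy)
  · intro i j hij
    rw [evalMat_apply, Matrix.of_apply, if_neg (not_lt.2 hij)]
    rfl
  · intro i j hij
    have hlt : i < j := by rw [Fin.lt_def]; omega
    rw [evalMat_apply, Matrix.of_apply, if_pos hlt]
    simp only [g, if_pos hij]
    change (f i j : Λ → ℂ) x + (indFun _ (hZ i j) : Λ → ℂ) x ≠ 0
    by_cases hx : (f i j : Λ → ℂ) x = 0
    · rw [indFun_of_mem (hZ i j) hx, hx, zero_add]
      exact one_ne_zero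
    · rw [indFun_of_notMem (hZ i j) hx, add_zero]
      exact hx
  · rw [upperTriangularOp, matOp_apply]
    congr 1
    refine Matrix.ext fun i j => ?_
    simp only [Matrix.of_apply, Matrix.map_apply, Matrix.add_apply, Matrix.diagonal_apply]
    split_ifs with h1 h2 h3
    · exact absurd h2 (h1 ▸ lt_irrefl _)
    · rw [add_zero, hψop]
    · rw [zero_add, hgop]
    · rw [add_zero, map_zero]

end Commutant

/-! ### Rank one idempotents -/

section RankOne

open scoped Matrix

variable {m n : ℕ}

theorem isIdempotentElem_vecMulVec {R : Type*} [Ring R] {u v : Fin m → R} (h : v ⬝ᵥ u = 1) :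
    IsIdempotentElem (Matrix.vecMulVec u v) := by
  rw [IsIdempotentElem, Matrix.vecMulVec_mul_vecMulVec, h, one_smul]

variable {N : Matrix (Fin n) (Fin n) ℂ}

theorem blocksCommute_vecMulVec {u v : Fin m → Matrix (Fin n) (Fin n) ℂ}
    (hu : ∀ i, Commute (u i) N) (hv : ∀ i, Commute (v i) N) :
    BlocksCommute N (Matrix.vecMulVec u v) := fun i j => (hu i).mul_left (hv j)

theorem BlocksCommute.sum {ι : Type*} {s : Finset ι}
    {F : ι → Matrix (Fin m) (Fin m) (Matrix (Fin n) (Fin n) ℂ)}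
    (h : ∀ k ∈ s, BlocksCommute N (F k)) : BlocksCommute N (∑ k ∈ s, F k) := fun i j => by
  rw [Matrix.sum_apply]
  exact Commute.sum_left _ _ _ fun k hk => h k hk i j

/-- The complement of a sum of rank one idempotents given by a biorthogonal system. -/
def biorthCompl (u v : ℕ → Fin m → Matrix (Fin n) (Fin n) ℂ) (r : ℕ) :
    Matrix (Fin m) (Fin m) (Matrix (Fin n) (Fin n) ℂ) :=
  1 - ∑ k ∈ Finset.range r, Matrix.vecMulVec (u k) (v k)

variable {u v : ℕ → Fin m → Matrix (Fin n) (Fin n) ℂ} {r : ℕ}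

theorem vecMul_biorthCompl (h : ∀ k < r, ∀ l < r, v k ⬝ᵥ u l = if k = l then 1 else 0) {k : ℕ}
    (hk : k < r) : v k ᵥ* biorthCompl u v r = 0 := by
  rw [biorthCompl, Matrix.vecMul_sub, Matrix.vecMul_one, Matrix.vecMul_sum,
    Finset.sum_eq_single k, Matrix.vecMul_vecMulVec, h k hk k hk]
  · simp
  · intro l hl hlk
    rw [Matrix.vecMul_vecMulVec, h k hk l (Finset.mem_range.1 hl), if_neg hlk.symm, zero_smul]
  · intro h'
    exact absurd (Finset.mem_range.2 hk) h'

theorem biorthCompl_mulVec (h : ∀ k < r, ∀ l < r, v k ⬝ᵥ u l = if k = l then 1 else 0) {k : ℕ}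
    (hk : k < r) : biorthCompl u v r *ᵥ u k = 0 := by
  rw [biorthCompl, Matrix.sub_mulVec, Matrix.one_mulVec, Matrix.sum_mulVec,
    Finset.sum_eq_single k, Matrix.vecMulVec_mulVec, h k hk k hk]
  · simp
  · intro l hl hlk
    rw [Matrix.vecMulVec_mulVec, h l (Finset.mem_range.1 hl) k hk, if_neg hlk]
    simp
  · intro h'
    exact absurd (Finset.mem_range.2 hk) h'

theorem isIdempotentElem_biorthCompl
    (h : ∀ k < r, ∀ l < r, v k ⬝ᵥ u l = if k = l then 1 else 0) :
    IsIdempotentElem (biorthCompl u v r) := by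
  rw [IsIdempotentElem]
  nth_rw 2 [biorthCompl]
  rw [mul_sub, mul_one, Finset.mul_sum, Finset.sum_eq_zero, sub_zero]
  intro k hk
  rw [Matrix.mul_vecMulVec, biorthCompl_mulVec h (Finset.mem_range.1 hk), Matrix.zero_vecMulVec]

theorem blocksCommute_biorthCompl (hu : ∀ k i, Commute (u k i) N) (hv : ∀ k i, Commute (v k i) N) :
    BlocksCommute N (biorthCompl u v r) :=
  blocksCommute_one.sub (BlocksCommute.sum fun k _ => blocksCommute_vecMulVec (hu k) (hv k))

variable [NeZero n]

theorem lead_sum {ι : Type*} (s : Finset ι)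
    (F : ι → Matrix (Fin m) (Fin m) (Matrix (Fin n) (Fin n) ℂ)) :
    lead (∑ k ∈ s, F k) = ∑ k ∈ s, lead (F k) := by
  ext i j
  simp [lead, Matrix.sum_apply]

theorem IsJordanLike.trace_lead_vecMulVec (hN : IsJordanLike N)
    {u v : Fin m → Matrix (Fin n) (Fin n) ℂ} (hu : ∀ i, Commute (u i) N)
    (hv : ∀ i, Commute (v i) N) (h : v ⬝ᵥ u = 1) : (lead (Matrix.vecMulVec u v)).trace = 1 := by
  have h2 := congrFun (congrFun h 0) 0
  rw [dotProduct, Matrix.sum_apply, Matrix.one_apply_eq] at h2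
  rw [← h2]
  simp only [Matrix.trace, lead, Matrix.diag_apply, Matrix.map_apply, Matrix.vecMulVec_apply]
  refine Finset.sum_congr rfl fun i _ => ?_
  rw [hN.mul_zero_zero (hv i), hN.mul_zero_zero (hu i), mul_comm]

theorem IsJordanLike.leadRank_biorthCompl (hN : IsJordanLike N) (hu : ∀ k i, Commute (u k i) N)
    (hv : ∀ k i, Commute (v k i) N)
    (h : ∀ k < r, ∀ l < r, v k ⬝ᵥ u l = if k = l then 1 else 0) :
    leadRank (biorthCompl u v r) + r = m := by
  have h1 := hN.cast_leadRank (blocksCommute_biorthCompl (r := r) hu hv)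
    (isIdempotentElem_biorthCompl h)
  rw [biorthCompl, lead_sub, lead_one, lead_sum, Matrix.trace_sub, Matrix.trace_one,
    Matrix.trace_sum, Finset.sum_congr rfl fun k hk => hN.trace_lead_vecMulVec (hu k) (hv k)
      (by rw [h k (Finset.mem_range.1 hk) k (Finset.mem_range.1 hk), if_pos rfl])] at h1
  simp only [Fintype.card_fin, Finset.sum_const, Finset.card_range, nsmul_eq_mul, mul_one] at h1
  have h2 : ((leadRank (biorthCompl u v r) + r : ℕ) : ℂ) = (m : ℕ) := by
    rw [Nat.cast_add, biorthCompl, h1]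
    ring
  exact_mod_cast h2

end RankOne

section Factorization

open scoped Matrix

variable {Λ : Type*} [MeasurableSpace Λ] {m n : ℕ}

/-- An everywhere idempotent symbol whose blocks commute with `N`. -/
structure IsIdemSymbol (N : Matrix (Fin n) (Fin n) (BddFun Λ)) (F : MatSymbol Λ m n) : Prop where
  commutes : SymCommutes N F
  idem : ∀ x, IsIdempotentElem (evalSym x F)

variable [NeZero n]

/-- The points where `i` is the first index such that the leading entry of the `i`-th diagonal
block of `F` has modulus at least `1/m`. -/
def pivotSet (F : MatSymbol Λ m n) (i : Fin m) : Set Λ :=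
  {x | (m : ℝ)⁻¹ ≤ ‖evalSym x F i i 0 0‖ ∧ ∀ j < i, ‖evalSym x F j j 0 0‖ < (m : ℝ)⁻¹}

theorem measurableSet_pivotSet (F : MatSymbol Λ m n) (i : Fin m) :
    MeasurableSet (pivotSet F i) := by
  have : pivotSet F i = {x | (m : ℝ)⁻¹ ≤ ‖evalSym x F i i 0 0‖} ∩
      ⋂ j, ⋂ (_ : j < i), {x | ‖evalSym x F j j 0 0‖ < (m : ℝ)⁻¹} := by
    ext x
    simp [pivotSet]
  rw [this]
  refine (measurableSet_le measurable_const (measurable_evalSym F i i 0 0).norm).inter ?_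
  exact MeasurableSet.iInter fun j => MeasurableSet.iInter fun _ =>
    measurableSet_lt (measurable_evalSym F j j 0 0).norm measurable_const

theorem pivotSet_unique {F : MatSymbol Λ m n} {i j : Fin m} {x : Λ} (hi : x ∈ pivotSet F i)
    (hj : x ∈ pivotSet F j) : i = j := by
  rcases lt_trichotomy i j with h | h | h
  · exact absurd (hj.2 i h) (not_lt.2 hi.1)
  · exact h
  · exact absurd (hi.2 j h) (not_lt.2 hj.1)

theorem exists_mem_pivotSet {N : Matrix (Fin n) (Fin n) (BddFun Λ)}
    (hN : ∀ x, IsJordanLike (evalMat x N)) {F : MatSymbol Λ m n} (hF : IsIdemSymbol N F) {x : Λ}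
    (hx : evalSym x F ≠ 0) : ∃ i, x ∈ pivotSet F i := by
  obtain ⟨i, hi⟩ := (hN x).exists_le_norm_lead (hF.commutes x) (hF.idem x) hx
  have hne : (Finset.univ.filter fun i => (m : ℝ)⁻¹ ≤ ‖evalSym x F i i 0 0‖).Nonempty :=
    ⟨i, by simpa using hi⟩
  refine ⟨Finset.min' _ hne, by simpa using Finset.min'_mem _ hne, fun j hj => ?_⟩
  by_contra! hcon
  exact absurd (Finset.min'_le _ j (by simpa using hcon)) (not_le.2 hj)

/-- On a set where the leading entry is bounded away from zero, a matrix function whose values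
commute with `N` is boundedly invertible: the inverse is the adjugate divided by the determinant,
which is the `n`-th power of the leading entry. -/
theorem exists_inv_on {N A : Matrix (Fin n) (Fin n) (BddFun Λ)}
    (hN : ∀ x, IsJordanLike (evalMat x N)) (hA : ∀ x, Commute (evalMat x A) (evalMat x N))
    {S : Set Λ} (hS : MeasurableSet S) {ε : ℝ} (hε : 0 < ε)
    (h : ∀ x ∈ S, ε ≤ ‖evalMat x A 0 0‖) :
    ∃ W : Matrix (Fin n) (Fin n) (BddFun Λ), (∀ x ∈ S, evalMat x A * evalMat x W = 1) ∧
      (∀ x ∉ S, evalMat x W = 0) ∧ ∀ x, Commute (evalMat x W) (evalMat x N) := by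
  have hdet : ∀ x, (A.det : Λ → ℂ) x = (evalMat x A 0 0) ^ n := fun x => by
    rw [← (hN x).det_of_commute (hA x)]
    exact (evalFun x).map_det A
  have hb : ∀ x, ‖S.indicator (fun x => ((A.det : Λ → ℂ) x)⁻¹) x‖ ≤ (ε ^ n)⁻¹ := by
    intro x
    by_cases hx : x ∈ S
    · rw [Set.indicator_of_mem hx, norm_inv, hdet, norm_pow]
      exact inv_anti₀ (by positivity) (pow_le_pow_left₀ hε.le (h x hx) n)
    · rw [Set.indicator_of_notMem hx, norm_zero]
      positivity
  let g : BddFun Λ := ⟨S.indicator fun x => ((A.det : Λ → ℂ) x)⁻¹,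
    A.det.2.1.inv.indicator hS, _, hb⟩
  have hmul : ∀ x ∈ S, evalMat x A * evalMat x (g • A.adjugate) = 1 := by
    intro x hx
    rw [← map_mul, Matrix.mul_smul, Matrix.mul_adjugate, smul_smul]
    have h1 : evalFun x (g * A.det) = 1 := by
      rw [map_mul, evalFun_apply, evalFun_apply]
      change S.indicator (fun x => ((A.det : Λ → ℂ) x)⁻¹) x * _ = 1
      rw [Set.indicator_of_mem hx, inv_mul_cancel₀]
      rw [hdet]
      exact pow_ne_zero _ (norm_pos_iff.1 (hε.trans_le (h x hx)))
    ext i j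
    change evalFun x (g * A.det * (1 : Matrix (Fin n) (Fin n) (BddFun Λ)) i j) = _
    rw [map_mul, h1, one_mul, Matrix.one_apply, Matrix.one_apply]
    split_ifs <;> simp
  have hzero : ∀ x ∉ S, evalMat x (g • A.adjugate) = 0 := by
    intro x hx
    ext i j
    change S.indicator (fun x => ((A.det : Λ → ℂ) x)⁻¹) x * (A.adjugate i j : Λ → ℂ) x = _
    rw [Set.indicator_of_notMem hx, zero_mul]
    rfl
  refine ⟨g • A.adjugate, hmul, hzero, fun x => ?_⟩
  by_cases hx : x ∈ S
  · have h1 := hmul x hx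
    have h2 := mul_eq_one_comm.1 h1
    generalize evalMat x (g • A.adjugate) = W at h1 h2
    calc W * evalMat x N = W * evalMat x N * (evalMat x A * W) := by rw [h1, mul_one]
      _ = W * (evalMat x N * evalMat x A) * W := by simp only [mul_assoc]
      _ = W * (evalMat x A * evalMat x N) * W := by rw [(hA x).eq]
      _ = (W * evalMat x A) * (evalMat x N * W) := by simp only [mul_assoc]
      _ = _ := by rw [h2, one_mul]
  · rw [hzero x hx]
    exact Commute.zero_left _

/-- Every idempotent symbol dominates a rank one idempotent `u v` with `v u = 1` on its support.
At a point with pivot `i`, `u` is the `i`-th column of `F` divided by the `i`-th diagonal block and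
`v` is the `i`-th row of `F`. -/
theorem IsIdemSymbol.exists_rankOne {N : Matrix (Fin n) (Fin n) (BddFun Λ)}
    (hN : ∀ x, IsJordanLike (evalMat x N)) {F : MatSymbol Λ m n} (hF : IsIdemSymbol N F) :
    ∃ u v : Fin m → Matrix (Fin n) (Fin n) (BddFun Λ),
      (∀ x i, Commute (evalMat x (u i)) (evalMat x N)) ∧
      (∀ x i, Commute (evalMat x (v i)) (evalMat x N)) ∧
      (∀ x, evalSym x F *ᵥ (fun i => evalMat x (u i)) = fun i => evalMat x (u i)) ∧
      (∀ x, (fun i => evalMat x (v i)) ᵥ* evalSym x F = fun i => evalMat x (v i)) ∧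
      (∀ x, evalSym x F = 0 → ∀ i, evalMat x (u i) = 0) ∧
      ∀ x, evalSym x F ≠ 0 →
        (fun i => evalMat x (v i)) ⬝ᵥ (fun i => evalMat x (u i)) = 1 := by
  rcases Nat.eq_zero_or_pos m with rfl | hm
  · exact ⟨0, 0, fun x i => i.elim0, fun x i => i.elim0, fun x => funext fun i => i.elim0,
      fun x => funext fun i => i.elim0, fun x _ i => i.elim0,
      fun x h => absurd (Matrix.ext fun i => i.elim0) h⟩
  have hS := measurableSet_pivotSet F
  have hm' : (0 : ℝ) < (m : ℝ)⁻¹ := by positivity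
  choose W hW1 hW0 hWN using fun i => exists_inv_on hN (fun x => hF.commutes x i i) (hS i)
    hm' (fun x hx => hx.1)
  let u : Fin m → Matrix (Fin n) (Fin n) (BddFun Λ) := fun k => ∑ i, F k i * W i
  let v : Fin m → Matrix (Fin n) (Fin n) (BddFun Λ) := fun k => ∑ i, indFun _ (hS i) • F i k
  have hind : ∀ x i (A : Matrix (Fin n) (Fin n) (BddFun Λ)),
      evalMat x (indFun _ (hS i) • A) = (indFun _ (hS i) : Λ → ℂ) x • evalMat x A :=
    fun x i A => rfl
  have hu : ∀ x k, evalMat x (u k) = ∑ i, evalSym x F k i * evalMat x (W i) := fun x k => by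
    simp only [u, map_sum, map_mul]
    rfl
  have hv : ∀ x k, evalMat x (v k) =
      ∑ i, (indFun _ (hS i) : Λ → ℂ) x • evalSym x F i k := fun x k => by
    simp only [v, map_sum, hind]
    rfl
  have hu1 : ∀ x i, x ∈ pivotSet F i → ∀ k, evalMat x (u k) =
      evalSym x F k i * evalMat x (W i) := fun x i hi k => by
    rw [hu, Finset.sum_eq_single i]
    · intro j _ hj
      rw [hW0 j x fun h => hj (pivotSet_unique h hi), mul_zero]
    · simp
  have hv1 : ∀ x i, x ∈ pivotSet F i → ∀ k, evalMat x (v k) = evalSym x F i k := fun x i hi k => by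
    rw [hv, Finset.sum_eq_single i]
    · rw [indFun_of_mem (hS i) hi, one_smul]
    · intro j _ hj
      rw [indFun_of_notMem (hS j) fun h => hj (pivotSet_unique h hi), zero_smul]
    · simp
  refine ⟨u, v, fun x k => ?_, fun x k => ?_, fun x => ?_, fun x => ?_, fun x hx k => ?_,
    fun x hx => ?_⟩
  · rw [hu]
    exact Commute.sum_left _ _ _ fun i _ => (hF.commutes x k i).mul_left (hWN i x)
  · rw [hv]
    exact Commute.sum_left _ _ _ fun i _ => (hF.commutes x i k).smul_left _
  · funext k
    simp only [Matrix.mulVec, dotProduct, hu, Finset.mul_sum]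
    rw [Finset.sum_comm]
    refine Finset.sum_congr rfl fun i _ => ?_
    simp only [← mul_assoc]
    rw [← Finset.sum_mul, ← Matrix.mul_apply, (hF.idem x).eq]
  · funext k
    simp only [Matrix.vecMul, dotProduct, hv, Finset.sum_mul]
    rw [Finset.sum_comm]
    refine Finset.sum_congr rfl fun i _ => ?_
    simp only [smul_mul_assoc]
    rw [← Finset.smul_sum, ← Matrix.mul_apply, (hF.idem x).eq]
  · rw [hu, hx]
    simp
  · obtain ⟨i, hi⟩ := exists_mem_pivotSet hN hF hx
    simp only [dotProduct, hu1 x i hi, hv1 x i hi, ← mul_assoc]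
    rw [← Finset.sum_mul, ← Matrix.mul_apply, (hF.idem x).eq]
    exact hW1 i x hi

end Factorization

/-! ### Maximal abelian sets of idempotents and minimal members -/

section Selection

open scoped Matrix

variable {Λ : Type*} [MeasurableSpace Λ] {μ : Measure Λ} {m n : ℕ}

/-- The operators whose symbol has all blocks commuting with `N`. -/
def symbolAlgebra (μ : Measure Λ) (m : ℕ) (N : Matrix (Fin n) (Fin n) (BddFun Λ)) :
    Set (HilbertPow m (HilbertPow n (Lp ℂ 2 μ)) →L[ℂ] HilbertPow m (HilbertPow n (Lp ℂ 2 μ))) :=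
  symOp μ m n '' {F | SymCommutes N F}

variable {N : Matrix (Fin n) (Fin n) (BddFun Λ)}
  {𝒬 : Set (HilbertPow m (HilbertPow n (Lp ℂ 2 μ)) →L[ℂ] HilbertPow m (HilbertPow n (Lp ℂ 2 μ)))}

theorem isIdemSymbol_of_forall_mem {F G : MatSymbol Λ m n} {S : Set Λ} (hF : SymCommutes N F)
    (hS : ∀ x ∈ S, IsIdempotentElem (evalSym x F)) (h1 : ∀ x ∈ S, evalSym x G = evalSym x F)
    (h0 : ∀ x ∉ S, evalSym x G = 0) : IsIdemSymbol N G := by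
  constructor
  · intro x
    by_cases hx : x ∈ S
    · rw [h1 x hx]
      exact hF x
    · rw [h0 x hx]
      exact blocksCommute_zero
  · intro x
    by_cases hx : x ∈ S
    · rw [h1 x hx]
      exact hS x hx
    · rw [h0 x hx]
      exact IsIdempotentElem.zero

theorem isIdempotentElem_symOp {F : MatSymbol Λ m n} (hF : IsIdemSymbol N F) :
    IsIdempotentElem (symOp μ m n F) := by
  rw [IsIdempotentElem, ← map_mul]
  congr 1
  refine evalSym_injective fun x => ?_
  rw [map_mul, (hF.idem x).eq]

variable [SigmaFinite μ]

/-- An idempotent operator in the symbol algebra has an everywhere idempotent symbol, bounded by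
the operator norm. -/
theorem exists_isIdemSymbol {B : HilbertPow m (HilbertPow n (Lp ℂ 2 μ)) →L[ℂ]
      HilbertPow m (HilbertPow n (Lp ℂ 2 μ))}
    (hB : B ∈ symbolAlgebra μ m N) (hBi : IsIdempotentElem B) :
    ∃ F : MatSymbol Λ m n, IsIdemSymbol N F ∧ symOp μ m n F = B ∧
      ∀ x i j a b, ‖evalSym x F i j a b‖ ≤ ‖B‖ := by
  obtain ⟨F, hF, rfl⟩ := hB
  have h1 : ∀ᵐ x ∂μ, evalSym x (F * F) = evalSym x F := by
    rw [← symOp_eq_iff, map_mul]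
    exact hBi
  obtain ⟨S, hSμ, hS, hSx⟩ :=
    (h1.and (ae_norm_le_norm_symOp (μ := μ) F)).exists_measurable_mem
  obtain ⟨G, hG1, hG0⟩ := exists_symbol_indicator F hS
  refine ⟨G, isIdemSymbol_of_forall_mem hF (fun x hx => ?_) hG1 hG0, ?_, ?_⟩
  · have := (hSx x hx).1
    rwa [map_mul] at this
  · rw [symOp_eq_iff]
    filter_upwards [hSμ] with x hx
    exact hG1 x hx
  · intro x i j a b
    by_cases hx : x ∈ S
    · rw [hG1 x hx]
      exact (hSx x hx).2 i j a b
    · rw [hG0 x hx]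
      simp

theorem commute_symOp_iff {F G : MatSymbol Λ m n} :
    Commute (symOp μ m n F) (symOp μ m n G) ↔
      ∀ᵐ x ∂μ, Commute (evalSym x F) (evalSym x G) := by
  rw [Commute, SemiconjBy, ← map_mul, ← map_mul, symOp_eq_iff]
  simp only [map_mul]
  rfl

/-- An idempotent symbol commuting with a maximal abelian set of idempotents belongs to it. -/
theorem symOp_mem_of_commute (hQ : IsBddMaxAbelianIdempotentSet (symbolAlgebra μ m N) 𝒬)
    {H : MatSymbol Λ m n} (hH : IsIdemSymbol N H)
    (h : ∀ F, IsIdemSymbol N F → symOp μ m n F ∈ 𝒬 →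
      ∀ᵐ x ∂μ, Commute (evalSym x H) (evalSym x F)) : symOp μ m n H ∈ 𝒬 := by
  have hc : ∀ P ∈ 𝒬, symOp μ m n H * P = P * symOp μ m n H := by
    intro P hP
    obtain ⟨F, hF, rfl, -⟩ :=
      exists_isIdemSymbol (hQ.maximal.prop.subset hP) (hQ.maximal.prop.idempotent P hP)
    exact commute_symOp_iff.2 (h F hF hP)
  refine hQ.maximal.mem_of_prop_insert ⟨?_, ?_, ?_⟩
  · exact Set.insert_subset ⟨H, hH.commutes, rfl⟩ hQ.maximal.prop.subset
  · rintro P (rfl | hP)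
    · exact isIdempotentElem_symOp hH
    · exact hQ.maximal.prop.idempotent P hP
  · rintro P (rfl | hP) P' (rfl | hP')
    · rfl
    · exact hc P' hP'
    · exact (hc P hP).symm
    · exact hQ.maximal.prop.commute P hP P' hP'

theorem ae_commute_of_mem (hQ : IsBddMaxAbelianIdempotentSet (symbolAlgebra μ m N) 𝒬)
    {F G : MatSymbol Λ m n} (hF : symOp μ m n F ∈ 𝒬) (hG : symOp μ m n G ∈ 𝒬) :
    ∀ᵐ x ∂μ, Commute (evalSym x F) (evalSym x G) :=
  commute_symOp_iff.1 (hQ.maximal.prop.commute _ hF _ hG)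

/-- Countable gluing: a maximal abelian set of idempotents contains the symbols that are pointwise
chosen, in a measurable way, from a bounded sequence of its members. -/
theorem exists_glue (hQ : IsBddMaxAbelianIdempotentSet (symbolAlgebra μ m N) 𝒬)
    {F : ℕ → MatSymbol Λ m n} (hF : ∀ k, IsIdemSymbol N (F k))
    (hFQ : ∀ k, symOp μ m n (F k) ∈ 𝒬) {C : ℝ} (hC : ∀ k x i j a b, ‖evalSym x (F k) i j a b‖ ≤ C)
    {κ : Λ → ℕ} (hκ : Measurable κ) :
    ∃ G : MatSymbol Λ m n, IsIdemSymbol N G ∧ symOp μ m n G ∈ 𝒬 ∧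
      ∀ x, evalSym x G = evalSym x (F (κ x)) := by
  have hmeas : ∀ i j a b, Measurable fun x => evalSym x (F (κ x)) i j a b := by
    have key : ∀ h : ℕ → Λ → ℂ, (∀ k, Measurable (h k)) → Measurable fun x => h (κ x) x := by
      intro h hh
      have : Measurable fun p : Λ × ℕ => h p.2 p.1 := measurable_from_prod_countable_left hh
      exact this.comp (measurable_id.prodMk hκ)
    intro i j a b
    exact key (fun k x => evalSym x (F k) i j a b) fun k => measurable_evalSym (F k) i j a b
  obtain ⟨G, hG⟩ := exists_symbol (f := fun x => evalSym x (F (κ x))) hmeas (C := C)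
    fun x i j a b => hC (κ x) x i j a b
  have hGi : IsIdemSymbol N G :=
    ⟨fun x => by rw [hG]; exact (hF _).commutes x, fun x => by rw [hG]; exact (hF _).idem x⟩
  refine ⟨G, hGi, symOp_mem_of_commute hQ hGi fun F' _ hF'Q => ?_, hG⟩
  filter_upwards [ae_all_iff.2 fun k => ae_commute_of_mem hQ (hFQ k) hF'Q] with x hx
  rw [hG]
  exact hx (κ x)

/-- A maximal abelian set of idempotents is closed under products. -/
theorem exists_symbol_mul (hQ : IsBddMaxAbelianIdempotentSet (symbolAlgebra μ m N) 𝒬)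
    {F G : MatSymbol Λ m n} (hF : IsIdemSymbol N F) (hG : IsIdemSymbol N G)
    (hFQ : symOp μ m n F ∈ 𝒬) (hGQ : symOp μ m n G ∈ 𝒬) :
    ∃ P : MatSymbol Λ m n, IsIdemSymbol N P ∧ symOp μ m n P ∈ 𝒬 ∧
      ∀ᵐ x ∂μ, evalSym x P = evalSym x F * evalSym x G := by
  have hmem : symOp μ m n F * symOp μ m n G ∈ symbolAlgebra μ m N :=
    ⟨F * G, fun x => by rw [map_mul]; exact (hF.commutes x).mul (hG.commutes x), map_mul _ _ _⟩
  obtain ⟨P, hP, hPop, -⟩ := exists_isIdemSymbol hmem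
    ((isIdempotentElem_symOp hF).mul_of_commute (hQ.maximal.prop.commute _ hFQ _ hGQ)
      (isIdempotentElem_symOp hG))
  have hae : ∀ᵐ x ∂μ, evalSym x P = evalSym x F * evalSym x G := by
    rw [← map_mul, symOp_eq_iff] at hPop
    simpa only [map_mul] using hPop
  refine ⟨P, hP, symOp_mem_of_commute hQ hP fun K _ hKQ => ?_, hae⟩
  filter_upwards [hae, ae_commute_of_mem hQ hFQ hKQ, ae_commute_of_mem hQ hGQ hKQ]
    with x h1 h2 h3
  rw [h1]
  exact h2.mul_left h3

variable [NeZero n]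

theorem measurable_leadRank (F : MatSymbol Λ m n) : Measurable fun x => leadRank (evalSym x F) := by
  have h : Measurable fun x => (lead (evalSym x F)).trace := by
    simp only [Matrix.trace, Matrix.diag_apply, lead, Matrix.map_apply]
    exact Finset.measurable_fun_sum _ fun i _ => measurable_evalSym F i i 0 0
  exact Nat.measurable_floor.comp (Complex.measurable_re.comp h)

/-- A subidempotent of `E` in `𝒬` with the same support as `E` which is minimal at almost every
point: every member of `𝒬` either dominates it or annihilates it. It minimizes the integral of the
rank with respect to a finite measure equivalent to `μ`. -/
theorem exists_minimal (hN : ∀ x, IsJordanLike (evalMat x N))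
    (hQ : IsBddMaxAbelianIdempotentSet (symbolAlgebra μ m N) 𝒬)
    {E : MatSymbol Λ m n} (hE : IsIdemSymbol N E) (hEQ : symOp μ m n E ∈ 𝒬) :
    ∃ F : MatSymbol Λ m n, IsIdemSymbol N F ∧ symOp μ m n F ∈ 𝒬 ∧
      (∀ᵐ x ∂μ, evalSym x E * evalSym x F = evalSym x F ∧
        evalSym x F * evalSym x E = evalSym x F ∧ (evalSym x E ≠ 0 → evalSym x F ≠ 0)) ∧
      ∀ G : MatSymbol Λ m n, IsIdemSymbol N G → symOp μ m n G ∈ 𝒬 →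
        ∀ᵐ x ∂μ, evalSym x G * evalSym x F = evalSym x F ∨ evalSym x G * evalSym x F = 0 := by
  obtain ⟨C, hC⟩ := hQ.bounded
  let R : Λ → Matrix (Fin m) (Fin m) (Matrix (Fin n) (Fin n) ℂ) → Prop := fun x F =>
    evalSym x E * F = F ∧ F * evalSym x E = F ∧ (evalSym x E ≠ 0 → F ≠ 0)
  let 𝒢 : Set (MatSymbol Λ m n) := {F | IsIdemSymbol N F ∧ symOp μ m n F ∈ 𝒬 ∧
    (∀ x i j a b, ‖evalSym x F i j a b‖ ≤ C) ∧ ∀ᵐ x ∂μ, R x (evalSym x F)}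
  -- replacing a symbol by a bounded one representing the same operator
  have hrep : ∀ F, IsIdemSymbol N F → symOp μ m n F ∈ 𝒬 → (∀ᵐ x ∂μ, R x (evalSym x F)) →
      ∃ F' ∈ 𝒢, ∀ᵐ x ∂μ, evalSym x F' = evalSym x F := by
    intro F hF hFQ hFR
    obtain ⟨F', hF', hop, hb⟩ := exists_isIdemSymbol (hQ.maximal.prop.subset hFQ)
      (hQ.maximal.prop.idempotent _ hFQ)
    have hae := symOp_eq_iff.1 hop
    refine ⟨F', ⟨hF', by rw [hop]; exact hFQ,
      fun x i j a b => (hb x i j a b).trans (hC _ hFQ), ?_⟩, hae⟩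
    filter_upwards [hFR, hae] with x h1 h2
    rwa [h2]
  let f : MatSymbol Λ m n → ℝ≥0∞ := fun F => ∫⁻ x, (leadRank (evalSym x F) : ℝ≥0∞) ∂μ.toFinite
  have hne : (f '' 𝒢).Nonempty := by
    obtain ⟨F', hF', -⟩ := hrep E hE hEQ
      (Filter.Eventually.of_forall fun x => ⟨(hE.idem x).eq, (hE.idem x).eq, id⟩)
    exact ⟨_, F', hF', rfl⟩
  obtain ⟨s, -, hs, hsG⟩ := exists_seq_tendsto_sInf hne (OrderBot.bddBelow _)
  choose F hFG hFs using hsG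
  have hex : ∀ x, ∃ k, ∀ l, leadRank (evalSym x (F k)) ≤ leadRank (evalSym x (F l)) := fun x => by
    exact ⟨Function.argmin fun k => leadRank (evalSym x (F k)), fun l =>
      Function.argmin_le (fun k => leadRank (evalSym x (F k))) l⟩
  classical
  have hκ : Measurable fun x => Nat.find (hex x) := by
    refine measurable_find hex fun k => ?_
    have : {x | ∀ l, leadRank (evalSym x (F k)) ≤ leadRank (evalSym x (F l))} =
        ⋂ l, {x | leadRank (evalSym x (F k)) ≤ leadRank (evalSym x (F l))} := by
      ext x
      simp
    rw [this]
    exact MeasurableSet.iInter fun l =>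
      measurableSet_le (measurable_leadRank _) (measurable_leadRank _)
  obtain ⟨G, hG, hGQ, hGx⟩ := exists_glue hQ (fun k => (hFG k).1) (fun k => (hFG k).2.1)
    (fun k => (hFG k).2.2.1) hκ
  have hGR : ∀ᵐ x ∂μ, R x (evalSym x G) := by
    filter_upwards [ae_all_iff.2 fun k => (hFG k).2.2.2] with x hx
    rw [hGx]
    exact hx _
  have hGle : ∀ k, f G ≤ f (F k) := fun k => lintegral_mono fun x => by
    rw [hGx]
    exact Nat.cast_le.2 (Nat.find_spec (hex x) k)
  have hGmin : ∀ F' ∈ 𝒢, f G ≤ f F' := by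
    intro F' hF'
    have h1 : f G ≤ sInf (f '' 𝒢) :=
      ge_of_tendsto' hs fun k => (hGle k).trans_eq (hFs k)
    exact h1.trans (csInf_le (OrderBot.bddBelow _) ⟨F', hF', rfl⟩)
  refine ⟨G, hG, hGQ, hGR, fun K hK hKQ => ?_⟩
  obtain ⟨P, hP, hPQ, hPx⟩ := exists_symbol_mul hQ hK hG hKQ hGQ
  -- the set where `K` splits `G` properly
  let A : Set Λ := {x | 0 < leadRank (evalSym x P)} ∩
    {x | leadRank (evalSym x P) < leadRank (evalSym x G)}
  have hA : MeasurableSet A :=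
    (measurableSet_lt measurable_const (measurable_leadRank P)).inter
      (measurableSet_lt (measurable_leadRank P) (measurable_leadRank G))
  obtain ⟨C₁, hC₁⟩ := exists_symbol_bound P
  obtain ⟨C₂, hC₂⟩ := exists_symbol_bound G
  let FF : ℕ → MatSymbol Λ m n := fun k => if k = 0 then P else G
  have hκ' : Measurable (A.indicator (0 : Λ → ℕ) + Aᶜ.indicator 1) :=
    (measurable_zero.indicator hA).add (measurable_one.indicator hA.compl)
  obtain ⟨D, hD, hDQ, hDx⟩ := exists_glue hQ (F := FF) (C := max C₁ C₂)
    (fun k => by simp only [FF]; split_ifs; exacts [hP, hG])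
    (fun k => by simp only [FF]; split_ifs; exacts [hPQ, hGQ])
    (fun k x i j a b => by
      simp only [FF]
      split_ifs
      exacts [(hC₁ x i j a b).trans (le_max_left _ _), (hC₂ x i j a b).trans (le_max_right _ _)])
    hκ'
  have hD1 : ∀ x ∈ A, evalSym x D = evalSym x P := fun x hx => by
    rw [hDx]; simp [FF, hx]
  have hD2 : ∀ x ∉ A, evalSym x D = evalSym x G := fun x hx => by
    rw [hDx]; simp [FF, hx]
  have hDR : ∀ᵐ x ∂μ, R x (evalSym x D) := by
    filter_upwards [hGR, hPx, ae_commute_of_mem hQ hKQ hEQ] with x h1 h2 h3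
    by_cases hx : x ∈ A
    · rw [hD1 x hx]
      refine ⟨?_, ?_, fun _ h0 => ?_⟩
      · rw [h2, ← mul_assoc, ← h3.eq, mul_assoc, h1.1]
      · rw [h2, mul_assoc, h1.2.1]
      · have : 0 < leadRank (evalSym x P) := hx.1
        rw [h0, leadRank_zero] at this
        exact lt_irrefl _ this
    · rw [hD2 x hx]
      exact h1
  obtain ⟨D', hD', hDD'⟩ := hrep D hD hDQ hDR
  have hle : f G ≤ f D := by
    refine (hGmin D' hD').trans_eq (lintegral_congr_ae ?_)
    rw [Filter.EventuallyEq, ae_toFinite]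
    filter_upwards [hDD'] with x hx
    rw [hx]
  have hfin : f G ≠ ∞ := by
    refine ((lintegral_mono (g := fun _ => (m : ℝ≥0∞)) fun x => ?_).trans_lt ?_).ne
    · have := (hN x).leadRank_le blocksCommute_one (hG.commutes x) IsIdempotentElem.one (hG.idem x)
        (one_mul _) (mul_one _)
      rw [leadRank_one] at this
      exact Nat.cast_le.2 this
    · rw [lintegral_const]
      exact ENNReal.mul_lt_top (ENNReal.natCast_lt_top m) (measure_lt_top _ _)
  have hA0 : μ.toFinite A = 0 := by
    have h1 : f D + μ.toFinite A ≤ f G := by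
      rw [← lintegral_indicator_one hA, ← lintegral_add_right _ (measurable_one.indicator hA)]
      refine lintegral_mono fun x => ?_
      by_cases hx : x ∈ A
      · simp only [hx, Set.indicator_of_mem, Pi.one_apply]
        rw [hD1 x hx]
        exact_mod_cast Nat.succ_le_of_lt hx.2
      · simp only [hx, not_false_eq_true, Set.indicator_of_notMem, add_zero]
        rw [hD2 x hx]
    have h2 : f G + μ.toFinite A ≤ f G + 0 := by
      rw [add_zero]
      exact (add_le_add_left hle _).trans h1
    exact le_antisymm ((ENNReal.add_le_add_iff_left hfin).1 h2) zero_le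
  have hA0' : ∀ᵐ x ∂μ, x ∉ A := by
    rw [← ae_toFinite (μ := μ)]
    exact measure_eq_zero_iff_ae_notMem.1 hA0
  filter_upwards [hA0', hPx, ae_commute_of_mem hQ hKQ hGQ] with x hxA h2 h3
  by_cases h0 : leadRank (evalSym x P) = 0
  · right
    rw [← h2]
    exact (hN x).eq_zero_of_leadRank_eq_zero (hP.commutes x) (hP.idem x) h0
  · left
    rw [← h2]
    refine (hN x).eq_of_leadRank_le (hG.commutes x) (hP.commutes x) (hG.idem x) (hP.idem x)
      ?_ ?_ ?_
    · rw [h2, ← mul_assoc, ← h3.eq, mul_assoc, (hG.idem x).eq]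
    · rw [h2, mul_assoc, (hG.idem x).eq]
    · by_contra hlt
      exact hxA ⟨Nat.pos_of_ne_zero h0, not_le.1 hlt⟩

end Selection

/-! ### Biorthogonal systems -/

section Biorthogonal

open scoped Matrix

variable {Λ : Type*} [MeasurableSpace Λ] {μ : Measure Λ} {m n : ℕ}

/-- Evaluation of a vector of matrix functions at a point. -/
def evalVec (x : Λ) (u : Fin m → Matrix (Fin n) (Fin n) (BddFun Λ)) :
    Fin m → Matrix (Fin n) (Fin n) ℂ := fun i => evalMat x (u i)

theorem evalSym_vecMulVec (x : Λ) (u v : Fin m → Matrix (Fin n) (Fin n) (BddFun Λ)) :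
    evalSym x (Matrix.vecMulVec u v) = Matrix.vecMulVec (evalVec x u) (evalVec x v) :=
  Matrix.ext fun i j => map_mul (evalMat x) (u i) (v j)

variable [NeZero n] [SigmaFinite μ] {N : Matrix (Fin n) (Fin n) (BddFun Λ)}
  {𝒬 : Set (HilbertPow m (HilbertPow n (Lp ℂ 2 μ)) →L[ℂ] HilbertPow m (HilbertPow n (Lp ℂ 2 μ)))}

/-- Every member of `𝒬` dominates a member of `𝒬` which has rank one on its support. -/
theorem exists_rankOne_mem (hN : ∀ x, IsJordanLike (evalMat x N))
    (hQ : IsBddMaxAbelianIdempotentSet (symbolAlgebra μ m N) 𝒬)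
    {E : MatSymbol Λ m n} (hE : IsIdemSymbol N E) (hEQ : symOp μ m n E ∈ 𝒬) :
    ∃ u v : Fin m → Matrix (Fin n) (Fin n) (BddFun Λ),
      (∀ x i, Commute (evalVec x u i) (evalMat x N)) ∧
      (∀ x i, Commute (evalVec x v i) (evalMat x N)) ∧
      symOp μ m n (Matrix.vecMulVec u v) ∈ 𝒬 ∧
      ∀ᵐ x ∂μ, evalSym x E *ᵥ evalVec x u = evalVec x u ∧
        evalVec x v ᵥ* evalSym x E = evalVec x v ∧
        (evalSym x E ≠ 0 → evalVec x v ⬝ᵥ evalVec x u = 1) := by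
  obtain ⟨F, hF, hFQ, hFx, hFmin⟩ := exists_minimal hN hQ hE hEQ
  obtain ⟨u, v, hu, hv, hFu, hvF, h0, h1⟩ := hF.exists_rankOne hN
  have hFu' : ∀ x, evalSym x F *ᵥ evalVec x u = evalVec x u := hFu
  have hvF' : ∀ x, evalVec x v ᵥ* evalSym x F = evalVec x v := hvF
  have hH : IsIdemSymbol N (Matrix.vecMulVec u v) := by
    refine ⟨fun x => ?_, fun x => ?_⟩
    · rw [evalSym_vecMulVec]
      exact blocksCommute_vecMulVec (hu x) (hv x)
    · rw [evalSym_vecMulVec]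
      by_cases hx : evalSym x F = 0
      · have : evalVec x u = 0 := funext (h0 x hx)
        rw [this, Matrix.zero_vecMulVec]
        exact IsIdempotentElem.zero
      · exact isIdempotentElem_vecMulVec (h1 x hx)
  refine ⟨u, v, hu, hv, symOp_mem_of_commute hQ hH fun G hG hGQ => ?_, ?_⟩
  · filter_upwards [hFmin G hG hGQ, ae_commute_of_mem hQ hFQ hGQ] with x h2 h3
    have hGu : evalSym x G *ᵥ evalVec x u = (evalSym x G * evalSym x F) *ᵥ evalVec x u := by
      rw [← Matrix.mulVec_mulVec, hFu']
    have hvG : evalVec x v ᵥ* evalSym x G = evalVec x v ᵥ* (evalSym x G * evalSym x F) := by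
      rw [← h3.eq, ← Matrix.vecMul_vecMul, hvF']
    rw [evalSym_vecMulVec, Commute, SemiconjBy, Matrix.vecMulVec_mul, Matrix.mul_vecMulVec, hGu,
      hvG]
    rcases h2 with h2 | h2
    · rw [h2, hFu', hvF']
    · rw [h2, Matrix.zero_mulVec, Matrix.vecMul_zero, Matrix.zero_vecMulVec, Matrix.vecMulVec_zero]
  · filter_upwards [hFx] with x ⟨h2, h3, h4⟩
    refine ⟨?_, ?_, fun h => h1 x (h4 h)⟩
    · rw [← hFu' x, Matrix.mulVec_mulVec, h2]
    · rw [← hvF' x, Matrix.vecMul_vecMul, h3]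

/-- A bounded maximal abelian set of idempotents contains `m` rank one idempotents `u_k v_k` with
`v_k u_l = δ_kl`. -/
theorem exists_biorthogonal (hN : ∀ x, IsJordanLike (evalMat x N))
    (hQ : IsBddMaxAbelianIdempotentSet (symbolAlgebra μ m N) 𝒬) (r : ℕ) (hr : r ≤ m) :
    ∃ u v : ℕ → Fin m → Matrix (Fin n) (Fin n) (BddFun Λ),
      (∀ x k i, Commute (evalVec x (u k) i) (evalMat x N)) ∧
      (∀ x k i, Commute (evalVec x (v k) i) (evalMat x N)) ∧
      (∀ k < r, symOp μ m n (Matrix.vecMulVec (u k) (v k)) ∈ 𝒬) ∧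
      ∀ᵐ x ∂μ, ∀ k < r, ∀ l < r,
        evalVec x (v k) ⬝ᵥ evalVec x (u l) = if k = l then 1 else 0 := by
  induction r with
  | zero =>
    refine ⟨0, 0, fun x k i => ?_, fun x k i => ?_, fun k hk => absurd hk (Nat.not_lt_zero k),
      Filter.Eventually.of_forall fun x k hk => absurd hk (Nat.not_lt_zero k)⟩ <;>
    · change Commute (evalMat x 0) _
      rw [map_zero]
      exact Commute.zero_left _
  | succ r ih =>
    obtain ⟨u, v, hu, hv, huvQ, hδ⟩ := ih (by omega)
    -- the complement of the idempotents found so far lies in `𝒬` and has rank `m - r > 0`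
    let E : MatSymbol Λ m n := 1 - ∑ k ∈ Finset.range r, Matrix.vecMulVec (u k) (v k)
    have hEx : ∀ x, evalSym x E =
        biorthCompl (fun k => evalVec x (u k)) (fun k => evalVec x (v k)) r := fun x => by
      simp only [E, biorthCompl, map_sub, map_one, map_sum, evalSym_vecMulVec]
    have hEi : IsIdempotentElem (symOp μ m n E) := by
      rw [IsIdempotentElem, ← map_mul, symOp_eq_iff]
      filter_upwards [hδ] with x hx
      rw [map_mul, hEx]
      exact isIdempotentElem_biorthCompl hx
    obtain ⟨E', hE', hop, -⟩ := exists_isIdemSymbol (N := N)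
      ⟨E, fun x => by rw [hEx]; exact blocksCommute_biorthCompl (hu x) (hv x), rfl⟩ hEi
    have hEE' := symOp_eq_iff.1 hop
    have hE'Q : symOp μ m n E' ∈ 𝒬 := by
      refine symOp_mem_of_commute hQ hE' fun F _ hFQ => ?_
      have h1 : ∀ᵐ x ∂μ, ∀ k, k < r →
          Commute (evalSym x (Matrix.vecMulVec (u k) (v k))) (evalSym x F) := by
        rw [ae_all_iff]
        intro k
        by_cases hk : k < r
        · filter_upwards [ae_commute_of_mem hQ (huvQ k hk) hFQ] with x hx _
          exact hx
        · exact Filter.Eventually.of_forall fun x h => absurd h hk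
      filter_upwards [hEE', h1] with x h2 h3
      rw [h2]
      simp only [E, map_sub, map_one, map_sum]
      exact (Commute.one_left _).sub_left
        (Commute.sum_left _ _ _ fun k hk => h3 k (Finset.mem_range.1 hk))
    obtain ⟨u', v', hu', hv', huvQ', hx'⟩ := exists_rankOne_mem hN hQ hE' hE'Q
    refine ⟨Function.update u r u', Function.update v r v', fun x k i => ?_, fun x k i => ?_,
      fun k hk => ?_, ?_⟩
    · by_cases hk : k = r
      · subst hk; rw [Function.update_self]; exact hu' x i
      · rw [Function.update_of_ne hk]; exact hu x k i
    · by_cases hk : k = r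
      · subst hk; rw [Function.update_self]; exact hv' x i
      · rw [Function.update_of_ne hk]; exact hv x k i
    · by_cases hkr : k = r
      · subst hkr; rw [Function.update_self, Function.update_self]; exact huvQ'
      · rw [Function.update_of_ne hkr, Function.update_of_ne hkr]; exact huvQ k (by omega)
    · filter_upwards [hδ, hEE', hx'] with x h1 h2 ⟨h3, h4, h5⟩ k hk l hl
      rw [h2, hEx] at h3 h4 h5
      by_cases hkr : k = r <;> by_cases hlr : l = r
      · subst hkr; subst hlr
        rw [Function.update_self, Function.update_self, if_pos rfl]
        refine h5 fun h0 => ?_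
        have := (hN x).leadRank_biorthCompl (hu x) (hv x) h1
        rw [h0, leadRank_zero] at this
        omega
      · subst hkr
        rw [Function.update_self, Function.update_of_ne hlr, if_neg (Ne.symm hlr), ← h4,
          ← Matrix.dotProduct_mulVec]
        have := biorthCompl_mulVec h1 (show l < k by omega)
        rw [this, dotProduct_zero]
      · subst hlr
        rw [Function.update_self, Function.update_of_ne hkr, if_neg hkr, ← h3,
          Matrix.dotProduct_mulVec]
        have := vecMul_biorthCompl h1 (show k < l by omega)
        rw [this, zero_dotProduct]
      · rw [Function.update_of_ne hkr, Function.update_of_ne hlr]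
        exact h1 k (by omega) l (by omega)

/-- Some invertible symbol conjugates `𝒬` to a set containing the diagonal matrix units. -/
theorem exists_conj_single (hN : ∀ x, IsJordanLike (evalMat x N))
    (hQ : IsBddMaxAbelianIdempotentSet (symbolAlgebra μ m N) 𝒬) :
    ∃ X Y : MatSymbol Λ m n, SymCommutes N X ∧ SymCommutes N Y ∧
      symOp μ m n X * symOp μ m n Y = 1 ∧ symOp μ m n Y * symOp μ m n X = 1 ∧
      ∀ k, ∃ P ∈ 𝒬, symOp μ m n X * P * symOp μ m n Y = symOp μ m n (Matrix.single k k 1) := by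
  obtain ⟨u, v, hu, hv, huvQ, hδ⟩ := exists_biorthogonal hN hQ m le_rfl
  let X : MatSymbol Λ m n := Matrix.of fun i j => v i j
  let Y : MatSymbol Λ m n := Matrix.of fun i j => u j i
  have hXu : ∀ x (w : Fin m → Matrix (Fin n) (Fin n) ℂ) (k : Fin m),
      (evalSym x X *ᵥ w) k = evalVec x (v k) ⬝ᵥ w := fun _ _ _ => rfl
  have hvY : ∀ x (w : Fin m → Matrix (Fin n) (Fin n) ℂ) (k : Fin m),
      (w ᵥ* evalSym x Y) k = w ⬝ᵥ evalVec x (u k) := fun _ _ _ => rfl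
  refine ⟨X, Y, fun x i j => hv x i j, fun x i j => hu x j i, ?_, ?_, fun k =>
    ⟨_, huvQ k k.2, ?_⟩⟩
  · rw [← map_mul, ← map_one (symOp μ m n), symOp_eq_iff]
    filter_upwards [hδ] with x hx
    rw [map_mul, map_one]
    refine Matrix.ext fun i j => ?_
    rw [Matrix.one_apply]
    refine (hx i i.2 j j.2).trans ?_
    simp only [Fin.ext_iff]
  · rw [← map_mul, ← map_one (symOp μ m n), symOp_eq_iff]
    filter_upwards [hδ] with x hx
    have h1 := (hN x).leadRank_biorthCompl (hu x) (hv x) hx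
    have h2 := (hN x).eq_zero_of_leadRank_eq_zero (blocksCommute_biorthCompl (hu x) (hv x))
      (isIdempotentElem_biorthCompl hx) (by omega)
    rw [biorthCompl, sub_eq_zero] at h2
    rw [map_mul, map_one, h2, Finset.sum_range]
    refine Matrix.ext fun i j => ?_
    rw [Matrix.mul_apply, Matrix.sum_apply]
    rfl
  · rw [← map_mul, ← map_mul, symOp_eq_iff]
    filter_upwards [hδ] with x hx
    rw [map_mul, map_mul, evalSym_vecMulVec, Matrix.mul_vecMulVec, Matrix.vecMulVec_mul]
    have h1 : evalSym x X *ᵥ evalVec x (u k) = Pi.single k 1 := by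
      funext i
      rw [hXu, hx i i.2 k k.2, Pi.single_apply]
      simp only [Fin.ext_iff]
    have h2 : evalVec x (v k) ᵥ* evalSym x Y = Pi.single k 1 := by
      funext i
      rw [hvY, hx k k.2 i i.2, Pi.single_apply]
      simp only [Fin.ext_iff, eq_comm]
    have h3 : evalSym x (Matrix.single k k 1 : MatSymbol Λ m n) = Matrix.single k k 1 := by
      refine Matrix.ext fun i j => ?_
      rw [evalSym_apply, Matrix.single_apply, Matrix.single_apply]
      split_ifs
      · exact map_one _
      · exact map_zero _
    rw [h1, h2, h3, Matrix.single_eq_single_vecMulVec_single]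

end Biorthogonal

/-! ### Similarity to the direct sums of projections -/

section Similarity

variable {H : Type*} [NormedAddCommGroup H] [InnerProductSpace ℂ H] {A : H →L[ℂ] H}

theorem mul_mem_commutant {B C : H →L[ℂ] H} (hB : B ∈ commutant A) (hC : C ∈ commutant A) :
    B * C ∈ commutant A :=
  Commute.mul_right (show Commute A B from hB) (show Commute A C from hC)

/-- Conjugation by a unit `X` of the commutant preserves abelian sets of idempotents. -/
theorem IsAbelianIdempotentSet.conj {S : Set (H →L[ℂ] H)}
    (hS : IsAbelianIdempotentSet (commutant A) S) {X Y : H →L[ℂ] H} (hX : X ∈ commutant A)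
    (hY : Y ∈ commutant A) (hYX : Y * X = 1) :
    IsAbelianIdempotentSet (commutant A) ((fun P => X * P * Y) '' S) := by
  have hmul : ∀ P Q : H →L[ℂ] H, X * P * Y * (X * Q * Y) = X * (P * Q) * Y := by
    intro P Q
    calc X * P * Y * (X * Q * Y) = X * P * (Y * X) * Q * Y := by simp only [mul_assoc]
      _ = _ := by rw [hYX, mul_one]; simp only [mul_assoc]
  constructor
  · rintro _ ⟨P, hP, rfl⟩
    exact mul_mem_commutant (mul_mem_commutant hX (hS.subset hP)) hY
  · rintro _ ⟨P, hP, rfl⟩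
    rw [IsIdempotentElem, hmul, (hS.idempotent P hP).eq]
  · rintro _ ⟨P, hP, rfl⟩ _ ⟨Q, hQ, rfl⟩
    change X * P * Y * (X * Q * Y) = X * Q * Y * (X * P * Y)
    rw [hmul, hmul, hS.commute P hP Q hQ]

theorem AreSimilarIn.symm {S S' : Set (H →L[ℂ] H)} {𝒜 : Set (H →L[ℂ] H)}
    (h : AreSimilarIn 𝒜 S S') : AreSimilarIn 𝒜 S' S := by
  obtain ⟨X, hX, hX', rfl⟩ := h
  refine ⟨X⁻¹, hX', by rwa [inv_inv], ?_⟩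
  rw [Set.image_image]
  refine (Set.image_congr fun P _ => ?_).trans (Set.image_id S)
  rw [inv_inv]
  simp [mul_assoc]

theorem AreSimilarIn.trans {S S' S'' : Set (H →L[ℂ] H)}
    (h : AreSimilarIn (commutant A) S S') (h' : AreSimilarIn (commutant A) S' S'') :
    AreSimilarIn (commutant A) S S'' := by
  obtain ⟨X, hX, hX', rfl⟩ := h
  obtain ⟨Y, hY, hY', rfl⟩ := h'
  refine ⟨Y * X, by rw [Units.val_mul]; exact mul_mem_commutant hY hX,
    by rw [mul_inv_rev, Units.val_mul]; exact mul_mem_commutant hX' hY', ?_⟩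
  rw [Set.image_image]
  refine Set.image_congr fun P _ => ?_
  rw [mul_inv_rev, Units.val_mul, Units.val_mul]
  simp only [mul_assoc]

end Similarity

section DirectSum

variable {k : ℕ} {H : Type*} [NormedAddCommGroup H] [InnerProductSpace ℂ H]

theorem opDiag_mul (D D' : Fin k → (H →L[ℂ] H)) :
    opDiag D * opDiag D' = opDiag fun i => D i * D' i := by
  rw [opDiag, opDiag, opDiag, ← opMatrixEquiv_apply, ← opMatrixEquiv_apply, ← map_mul,
    Matrix.diagonal_mul_diagonal]
  rfl

end DirectSum

section Projections

variable {Λ : Type*} [MeasurableSpace Λ] {μ : Measure Λ} {m n : ℕ}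

theorem commutant_ampliation_eq [StandardBorelSpace Λ] [SigmaFinite μ] {φ : BddFun Λ} {s : Set Λ}
    {N : Matrix (Fin n) (Fin n) (BddFun Λ)} (hs : μ sᶜ = 0) (hφ : Set.InjOn (φ : Λ → ℂ) s)
    (hN : ∀ x, IsJordanLike (evalMat x N)) :
    commutant (ampliation (matOp μ n (Matrix.diagonal (fun _ => φ) + N)) m) =
      symbolAlgebra μ m N := by
  ext B
  constructor
  · intro hB
    obtain ⟨F, hF, h⟩ := exists_symbol_of_mem_commutant hs hφ hN hB
    exact ⟨F, hF, h⟩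
  · rintro ⟨F, hF, rfl⟩
    exact mem_commutant_ampliation_of_symCommutes hF

theorem symOp_single_mem_directSumSet (k : Fin m)
    (T : HilbertPow n (Lp ℂ 2 μ) →L[ℂ] HilbertPow n (Lp ℂ 2 μ)) :
    symOp μ m n (Matrix.single k k 1) ∈ directSumSet (commutantProjections T) m := by
  refine ⟨fun i => if i = k then 1 else 0, fun i => ?_, ?_⟩
  · dsimp only
    split_ifs
    · exact ⟨Commute.one_right T, IsStarProjection.one _⟩
    · exact ⟨Commute.zero_right T, IsStarProjection.zero _⟩
  · rw [symOp_apply, opDiag]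
    congr 1
    refine Matrix.ext fun i j => ?_
    rw [Matrix.map_apply, Matrix.single_apply, Matrix.diagonal_apply]
    by_cases hij : i = j
    · subst hij
      by_cases hik : i = k
      · simp [hik]
      · simp [hik, Ne.symm hik]
    · rw [if_neg hij, if_neg, map_zero]
      rintro ⟨rfl, rfl⟩
      exact hij rfl

variable [NeZero n]

theorem IsJordanLike.eq_zero_or_one {N X : Matrix (Fin n) (Fin n) ℂ} (hN : IsJordanLike N)
    (hX : Commute X N) (hi : IsIdempotentElem X) : X = 0 ∨ X = 1 := by
  have key : ∀ Y : Matrix (Fin n) (Fin n) ℂ, Commute Y N → IsIdempotentElem Y → Y 0 0 = 0 →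
      Y = 0 := by
    intro Y hY hYi h0
    have h := hN.eq_zero_of_lead_eq_zero (F := Matrix.of fun _ _ : Fin 1 => Y) (fun _ _ => hY)
      (Matrix.ext fun i j => by simp [Matrix.mul_apply, hYi.eq])
      (Matrix.ext fun _ _ => h0)
    exact congrFun (congrFun h 0) 0
  have h00 : X 0 0 * X 0 0 = X 0 0 := by rw [← hN.mul_zero_zero hX, hi.eq]
  rcases IsIdempotentElem.iff_eq_zero_or_one.1 h00 with h | h
  · exact Or.inl (key X hX hi h)
  · right
    have := key (1 - X) ((Commute.one_left N).sub_left hX) hi.one_sub (by simp [h])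
    exact (sub_eq_zero.1 this).symm

/-- A matrix function with values `0` and `1` acts as multiplication by an indicator function, which
is an orthogonal projection. -/
theorem isStarProjection_matOp [SigmaFinite μ] {A : Matrix (Fin n) (Fin n) (BddFun Λ)}
    (hA : ∀ᵐ x ∂μ, evalMat x A = 0 ∨ evalMat x A = 1) : IsStarProjection (matOp μ n A) := by
  have hS := measurableSet_evalMat_eq A (1 : Matrix (Fin n) (Fin n) (BddFun Λ))
  have hA' : matOp μ n A = opDiag fun _ => mulHom μ (indFun _ hS) := by
    have : matOp μ n A = matOp μ n (Matrix.diagonal fun _ => indFun _ hS) := by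
      rw [matOp_eq_iff]
      filter_upwards [hA] with x hx
      rw [evalMat_diagonal_const]
      rcases hx with hx | hx
      · rw [indFun_of_notMem, hx, map_zero]
        rw [Set.mem_ofPred_eq, hx, map_one]
        exact zero_ne_one
      · rw [indFun_of_mem, hx, map_one]
        rw [Set.mem_ofPred_eq, hx, map_one]
    rw [this, matOp_apply, Matrix.diagonal_map (map_zero _)]
    rfl
  refine ⟨?_, ?_⟩
  · rw [IsIdempotentElem, ← map_mul, matOp_eq_iff]
    filter_upwards [hA] with x hx
    rw [map_mul]
    rcases hx with hx | hx <;> simp [hx]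
  · rw [hA']
    exact isSelfAdjoint_opDiag fun _ => isSelfAdjoint_mulHom_indFun _ _

variable [StandardBorelSpace Λ] [SigmaFinite μ] {φ : BddFun Λ} {s : Set Λ}
  {N : Matrix (Fin n) (Fin n) (BddFun Λ)}

theorem exists_matOp_of_idempotent (hs : μ sᶜ = 0) (hφ : Set.InjOn (φ : Λ → ℂ) s)
    (hN : ∀ x, IsJordanLike (evalMat x N))
    {B : HilbertPow n (Lp ℂ 2 μ) →L[ℂ] HilbertPow n (Lp ℂ 2 μ)}
    (hB : B ∈ commutant (matOp μ n (Matrix.diagonal (fun _ => φ) + N)))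
    (hBi : IsIdempotentElem B) :
    ∃ A, matOp μ n A = B ∧ ∀ᵐ x ∂μ, evalMat x A = 0 ∨ evalMat x A = 1 := by
  have hB' : Commute B (matOp μ n (Matrix.diagonal (fun _ => φ) + N)) := Eq.symm hB
  obtain ⟨A, rfl⟩ := exists_matOp_of_commute hs hφ hN hB'
  refine ⟨A, rfl, ?_⟩
  rw [Commute, SemiconjBy, ← map_mul, ← map_mul, matOp_eq_iff] at hB'
  rw [IsIdempotentElem, ← map_mul, matOp_eq_iff] at hBi
  filter_upwards [hB', hBi] with x h1 h2
  rw [map_mul, map_mul] at h1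
  rw [map_mul] at h2
  exact (hN x).eq_zero_or_one (commute_evalMat_diagonal_add_iff.1 h1) h2

theorem isAbelianIdempotentSet_directSumSet (hs : μ sᶜ = 0) (hφ : Set.InjOn (φ : Λ → ℂ) s)
    (hN : ∀ x, IsJordanLike (evalMat x N)) :
    IsAbelianIdempotentSet
      (commutant (ampliation (matOp μ n (Matrix.diagonal (fun _ => φ) + N)) m))
      (directSumSet (commutantProjections (matOp μ n (Matrix.diagonal (fun _ => φ) + N))) m) := by
  constructor
  · rintro _ ⟨D, hD, rfl⟩
    change opDiag _ * opDiag D = opDiag D * opDiag _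
    rw [opDiag_mul, opDiag_mul]
    congr 1
    exact funext fun i => (hD i).1
  · rintro _ ⟨D, hD, rfl⟩
    rw [IsIdempotentElem, opDiag_mul]
    congr 1
    exact funext fun i => (hD i).2.isIdempotentElem
  · rintro _ ⟨D, hD, rfl⟩ _ ⟨D', hD', rfl⟩
    rw [opDiag_mul, opDiag_mul]
    congr 1
    funext i
    obtain ⟨A, hA, hAx⟩ :=
      exists_matOp_of_idempotent hs hφ hN (hD i).1 (hD i).2.isIdempotentElem
    rw [← hA]
    obtain ⟨A', hA', -⟩ :=
      exists_matOp_of_idempotent hs hφ hN (hD' i).1 (hD' i).2.isIdempotentElem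
    rw [← hA', ← map_mul, ← map_mul, matOp_eq_iff]
    filter_upwards [hAx] with x hx
    rw [map_mul, map_mul]
    rcases hx with hx | hx <;> simp [hx]

/-- An abelian set of idempotents containing the diagonal matrix units consists of direct sums of
projections of `{T}'`. -/
theorem subset_directSumSet (hs : μ sᶜ = 0) (hφ : Set.InjOn (φ : Λ → ℂ) s)
    (hN : ∀ x, IsJordanLike (evalMat x N))
    {S : Set (HilbertPow m (HilbertPow n (Lp ℂ 2 μ)) →L[ℂ] HilbertPow m (HilbertPow n (Lp ℂ 2 μ)))}
    (hS : IsAbelianIdempotentSet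
      (commutant (ampliation (matOp μ n (Matrix.diagonal (fun _ => φ) + N)) m)) S)
    (h : ∀ k, symOp μ m n (Matrix.single k k 1) ∈ S) :
    S ⊆ directSumSet (commutantProjections (matOp μ n (Matrix.diagonal (fun _ => φ) + N))) m := by
  intro P hP
  have hmem := hS.subset hP
  rw [commutant_ampliation_eq hs hφ hN] at hmem
  obtain ⟨F, hF, rfl, -⟩ := exists_isIdemSymbol hmem (hS.idempotent P hP)
  have hcomm : ∀ᵐ x ∂μ, ∀ k, evalSym x (F * Matrix.single k k 1) =
      evalSym x (Matrix.single k k 1 * F) := by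
    rw [ae_all_iff]
    intro k
    rw [← symOp_eq_iff, map_mul, map_mul]
    exact hS.commute _ hP _ (h k)
  have hoff : ∀ᵐ x ∂μ, ∀ i j, i ≠ j → evalSym x F i j = 0 := by
    filter_upwards [hcomm] with x hx i j hij
    have h1 := congrFun (congrFun (hx j) i) j
    rw [evalSym_apply, evalSym_apply, Matrix.mul_single_apply_same, mul_one,
      Matrix.single_mul_apply_of_ne _ _ _ _ _ hij, map_zero] at h1
    exact h1
  have hdiag : ∀ i, ∀ᵐ x ∂μ, evalMat x (F i i) = 0 ∨ evalMat x (F i i) = 1 := by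
    intro i
    filter_upwards [hoff] with x hx
    refine (hN x).eq_zero_or_one (hF.commutes x i i) ?_
    have h1 := congrFun (congrFun (hF.idem x).eq i) i
    rw [Matrix.mul_apply, Finset.sum_eq_single i] at h1
    · exact h1
    · intro j _ hj
      rw [hx j i hj, mul_zero]
    · simp
  refine ⟨fun i => matOp μ n (F i i), fun i => ⟨?_, isStarProjection_matOp (hdiag i)⟩, ?_⟩
  · change _ * _ = _ * _
    rw [← map_mul, ← map_mul]
    congr 1
    refine evalMat_injective fun x => ?_
    rw [map_mul, map_mul]
    exact (commute_evalMat_diagonal_add_iff.2 (hF.commutes x i i)).eq.symm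
  · have h1 : symOp μ m n F = symOp μ m n (Matrix.diagonal fun i => F i i) := by
      rw [symOp_eq_iff]
      filter_upwards [hoff] with x hx
      refine Matrix.ext fun i j => ?_
      by_cases hij : i = j
      · subst hij
        rw [evalSym_apply, evalSym_apply, Matrix.diagonal_apply_eq]
      · rw [hx i j hij, evalSym_apply, Matrix.diagonal_apply_ne _ hij, map_zero]
    rw [h1, symOp_apply, Matrix.diagonal_map (map_zero _)]
    rfl

theorem isBddMaxAbelianIdempotentSet_directSumSet (hs : μ sᶜ = 0)
    (hφ : Set.InjOn (φ : Λ → ℂ) s) (hN : ∀ x, IsJordanLike (evalMat x N)) :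
    IsBddMaxAbelianIdempotentSet
      (commutant (ampliation (matOp μ n (Matrix.diagonal (fun _ => φ) + N)) m))
      (directSumSet (commutantProjections (matOp μ n (Matrix.diagonal (fun _ => φ) + N))) m) := by
  refine ⟨⟨isAbelianIdempotentSet_directSumSet hs hφ hN, fun S hS hle => ?_⟩, 1, ?_⟩
  · exact subset_directSumSet hs hφ hN hS fun k => hle (symOp_single_mem_directSumSet k _)
  · rintro _ ⟨D, hD, rfl⟩
    exact norm_opDiag_le fun i => (hD i).2.norm_le

/-- Every bounded maximal abelian set of idempotents is similar to the standard one. -/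
theorem areSimilarIn_directSumSet (hs : μ sᶜ = 0) (hφ : Set.InjOn (φ : Λ → ℂ) s)
    (hN : ∀ x, IsJordanLike (evalMat x N))
    {𝒬 : Set (HilbertPow m (HilbertPow n (Lp ℂ 2 μ)) →L[ℂ] HilbertPow m (HilbertPow n (Lp ℂ 2 μ)))}
    (hQ : IsBddMaxAbelianIdempotentSet
      (commutant (ampliation (matOp μ n (Matrix.diagonal (fun _ => φ) + N)) m)) 𝒬) :
    AreSimilarIn (commutant (ampliation (matOp μ n (Matrix.diagonal (fun _ => φ) + N)) m)) 𝒬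
      (directSumSet (commutantProjections (matOp μ n (Matrix.diagonal (fun _ => φ) + N))) m) := by
  have hQ' := hQ
  rw [commutant_ampliation_eq hs hφ hN] at hQ'
  obtain ⟨X, Y, hX, hY, hXY, hYX, hk⟩ := exists_conj_single hN hQ'
  have hX' := mem_commutant_ampliation_of_symCommutes (μ := μ) (φ := φ) hX
  have hY' := mem_commutant_ampliation_of_symCommutes (μ := μ) (φ := φ) hY
  refine ⟨⟨symOp μ m n X, symOp μ m n Y, hXY, hYX⟩, hX', hY', ?_⟩
  change (fun P => symOp μ m n X * P * symOp μ m n Y) '' 𝒬 = _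
  have hsub : (fun P => symOp μ m n X * P * symOp μ m n Y) '' 𝒬 ⊆ _ :=
    subset_directSumSet hs hφ hN (hQ.maximal.prop.conj hX' hY' hYX) fun k => hk k
  refine hsub.antisymm fun P hP => ?_
  -- conjugating back, maximality of `𝒬` gives the reverse inclusion
  have hback : 𝒬 ⊆ (fun P => symOp μ m n Y * P * symOp μ m n X) ''
      directSumSet (commutantProjections (matOp μ n (Matrix.diagonal (fun _ => φ) + N))) m := by
    intro B hB
    refine ⟨_, hsub ⟨B, hB, rfl⟩, ?_⟩
    calc symOp μ m n Y * (symOp μ m n X * B * symOp μ m n Y) * symOp μ m n X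
        = (symOp μ m n Y * symOp μ m n X) * B * (symOp μ m n Y * symOp μ m n X) := by
          simp only [mul_assoc]
      _ = B := by rw [hYX, one_mul, mul_one]
  have hle := hQ.maximal.le_of_ge
    ((isAbelianIdempotentSet_directSumSet hs hφ hN).conj hY' hX' hXY) hback
  refine ⟨_, hle ⟨P, hP, rfl⟩, ?_⟩
  calc symOp μ m n X * (symOp μ m n Y * P * symOp μ m n X) * symOp μ m n Y
      = (symOp μ m n X * symOp μ m n Y) * P * (symOp μ m n X * symOp μ m n Y) := by
        simp only [mul_assoc]
    _ = P := by rw [hXY, one_mul, mul_one]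

end Projections

theorem theorem3p3 {Λ : Type*} [MeasurableSpace Λ] [StandardBorelSpace Λ]
    (μ : Measure Λ) [SigmaFinite μ] (n : ℕ) (hn : 0 < n)
    (φ : Lp ℂ ∞ μ) (Φ : Fin n → Fin n → Lp ℂ ∞ μ)
    (hφ : ∃ s : Set Λ, μ sᶜ = 0 ∧ Set.InjOn φ s)
    (hΦ : ∀ i j : Fin n, (i : ℕ) + 1 = (j : ℕ) → ∀ᵐ x ∂μ, Φ i j x ≠ 0)
    (m : ℕ) (hm : 0 < m) :
    HasUniqueSID (ampliation (upperTriangularOp φ Φ) m) ∧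
      IsBddMaxAbelianIdempotentSet (commutant (ampliation (upperTriangularOp φ Φ) m))
        (directSumSet (commutantProjections (upperTriangularOp φ Φ)) m) ∧
      ∀ 𝒬 : Set (HilbertPow m (HilbertPow n (Lp ℂ 2 μ)) →L[ℂ]
            HilbertPow m (HilbertPow n (Lp ℂ 2 μ))),
        IsBddMaxAbelianIdempotentSet (commutant (ampliation (upperTriangularOp φ Φ) m)) 𝒬 →
          AreSimilarIn (commutant (ampliation (upperTriangularOp φ Φ) m)) 𝒬
            (directSumSet (commutantProjections (upperTriangularOp φ Φ)) m) := by

  have : NeZero n := ⟨hn.ne'⟩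
  obtain ⟨ψ, N, ⟨s, hs, hinj⟩, hN, hT⟩ := exists_upperTriangularOp_eq_matOp φ Φ hφ hΦ
  rw [hT]
  refine ⟨fun S S' hS hS' => ?_, isBddMaxAbelianIdempotentSet_directSumSet hs hinj hN,
    fun 𝒬 h𝒬 => areSimilarIn_directSumSet hs hinj hN h𝒬⟩
  exact (areSimilarIn_directSumSet hs hinj hN hS).trans
    (areSimilarIn_directSumSet hs hinj hN hS').symm
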